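/- **Conventions.** A non-decreasing $\Psi:(0,\infty)\to(0,\infty)$ has the weak scaling property with $(a_1,a_2)$, $0<a_1\le a_2<\infty$, if there are $c_1,c_2>0$ with $c_1(R/r)^{a_1}\le \Psi(R)/\Psi(r)\le c_2(R/r)^{a_2}$ for all $0<r\le R$; a family has it uniformly if $c_1,c_2$ do not depend on the member. We write $h\simeq f$ if $c_1f\le h\le c_2f$ with constants $c_1,c_2>0$ over the specified range. For an increasing $\Phi$ on $[0,\infty)$ put $\Phi^{-1}(t)=\inf\{s\ge0:\Phi(s)\ge t\}$. **Setting.** Let $(M,d)$ be a connected, locally compact, separable metric space satisfying the chain condition: there is $C>0$ such that for all $x,y\in M$ and $n\ge1$ there are $x=x_0,x_1,\dots,x_n=y$ in $M$ with $d(x_i,x_{i+1})\le C\,d(x,y)/n$ for $0\le i<n$. Let $\mu$ be a Radon measure on $M$ with full support, and suppose that $V(x,r)=\mu(B(x,r))$ has the weak scaling property uniformly in $x\in M$ with some $(d_1,d_2)$, $0<d_1\le d_2$. Let $S=(S_t)_{t\ge0}$ be a driftless subordinator with Laplace exponent $\phi$, $\mathbb E e^{-\lambda S_t}=e^{-t\phi(\lambda)}$,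 where $\phi$ has the weak scaling property with $(\beta_1,\beta_2)$, $0<\beta_1\le\beta_2<1$. Let $X$ be a conservative diffusion on $M$ (a strong Markov process with continuous sample paths and infinite lifetime), independent of $S$, having a transition density $q(t,x,y)$ with respect to $\mu$ such that, for some $C_1,c_1,C_2,c_2>0$ and all $t>0$, $x,y\in M$, $$\frac{C_1}{V(x,\Phi^{-1}(t))}e^{-c_1m(t,d(x,y))}\le q(t,x,y)\le \frac{C_2}{V(x,\Phi^{-1}(t))}e^{-c_2m(t,d(x,y))}.$$ Here $\Phi:[0,\infty)\to[0,\infty)$ is strictly increasing with $\Phi(0)=0$ and has the weak scaling property with $(\alpha_1,\alpha_2)$, $1<\alpha_1\le\alpha_2$; the function $m$ satisfies $m(t,r)>0$ for $t,r>0$ and $m(t,0)=0$, is non-increasing in $t>0$ for fixed $r>0$, and satisfies $\frac{t}{m(t,r)}\simeq\Phi\big(\frac{r}{m(t,r)}\big)$ for $t,r>0$. Put $$p(t,x,y)=\int_0^\infty q(r,x,y)\,d_r\mathbb P(S_r\ge t)\in[0,\infty],\qquad t>0,\ x,y\in M.$$ **Theorem.** (i) There are constants $c_1,c_2>0$ such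 that for all $t>0$ and $x,y\in M$ with $\Phi(d(x,y))\phi(t^{-1})\le1$, $$c_1\int_{\Phi(d(x,y))\phi(t^{-1})}^{2}\frac{dr}{V(x,\Phi^{-1}(r/\phi(t^{-1})))}\le p(t,x,y)\le c_2\int_{\Phi(d(x,y))\phi(t^{-1})}^{2}\frac{dr}{V(x,\Phi^{-1}(r/\phi(t^{-1})))}$$ (when $x=y$ both sides may be infinite). (ii) There is a function $n(t,r)>0$, $t,r>0$, non-increasing in $t$ for fixed $r$, with $$\frac{1}{\phi(n(t,r)/t)}\simeq\Phi\Big(\frac{r}{n(t,r)}\Big),\qquad t,r>0,$$ and for every such $n$ there are constants $c_1,c_2,c_3,c_4>0$ such that for all $t>0$ and $x,y\in M$ with $\Phi(d(x,y))\phi(t^{-1})\ge1$, $$\frac{c_1}{V(x,\Phi^{-1}(1/\phi(t^{-1})))}e^{-c_2n(t,d(x,y))}\le p(t,x,y)\le\frac{c_3}{V(x,\Phi^{-1}(1/\phi(t^{-1})))}e^{-c_4n(t,d(x,y))}.$$ -/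

import Mathlib

namespace TimeFractional

open MeasureTheory ProbabilityTheory Set
open scoped ENNReal NNReal

noncomputable section

/-! ### Scaling, inverses, volume, chains -/

/-- `Ψ : (0,∞) → (0,∞)` is non-decreasing and
`c₁ (R/r)^a₁ ≤ Ψ(R)/Ψ(r) ≤ c₂ (R/r)^a₂` for `0 < r ≤ R`. -/
structure WeakScalingWith (c₁ c₂ a₁ a₂ : ℝ) (Ψ : ℝ → ℝ) : Prop where
  pos : ∀ r, 0 < r → 0 < Ψ r
  mono : MonotoneOn Ψ (Ioi 0)
  lower : ∀ r R, 0 < r → r ≤ R → c₁ * (R / r) ^ a₁ ≤ Ψ R / Ψ r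
  upper : ∀ r R, 0 < r → r ≤ R → Ψ R / Ψ r ≤ c₂ * (R / r) ^ a₂

/-- A family of functions on `(0,∞)` has the weak scaling property uniformly with `(a₁, a₂)`. -/
def UniformWeakScaling {I : Type*} (a₁ a₂ : ℝ) (Ψ : I → ℝ → ℝ) : Prop :=
  0 < a₁ ∧ a₁ ≤ a₂ ∧ ∃ c₁ c₂ : ℝ, 0 < c₁ ∧ 0 < c₂ ∧ ∀ i, WeakScalingWith c₁ c₂ a₁ a₂ (Ψ i)

/-- The weak scaling property with `(a₁, a₂)` of a single function. -/
def WeakScaling (a₁ a₂ : ℝ) (Ψ : ℝ → ℝ) : Prop :=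
  0 < a₁ ∧ a₁ ≤ a₂ ∧ ∃ c₁ c₂ : ℝ, 0 < c₁ ∧ 0 < c₂ ∧ WeakScalingWith c₁ c₂ a₁ a₂ Ψ

/-- The inverse `Φ⁻¹(t) = inf {s ≥ 0 : Φ(s) ≥ t}` of an increasing function on `[0,∞)`. It is the
ordinary inverse when `Φ` is a bijection of `[0,∞)`, and makes sense if `Φ` has jumps. -/
def inv (Φ : ℝ → ℝ) (t : ℝ) : ℝ := sInf {s : ℝ | 0 ≤ s ∧ t ≤ Φ s}

/-- The volume `V(x,r) = μ(B(x,r))` as a real number (`0` if the ball has infinite measure, which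
the positivity in the weak scaling property excludes). -/
def vol {M : Type*} [MetricSpace M] [MeasurableSpace M] (μ : Measure M) (x : M) (r : ℝ) : ℝ :=
  μ.real (Metric.ball x r)

/-- The chain condition of a metric space. -/
def ChainCondition (M : Type*) [MetricSpace M] : Prop :=
  ∃ C : ℝ, 0 < C ∧ ∀ (x y : M) (n : ℕ), 0 < n →
    ∃ z : ℕ → M, z 0 = x ∧ z n = y ∧ ∀ i, i < n → dist (z i) (z (i + 1)) ≤ C * (dist x y / n)

/-! ### The subordinator -/

/-- A subordinator: a non-decreasing real valued Lévy process started at `0`. (The left limits of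
the paths exist by monotonicity.) -/
structure IsSubordinator {Ω : Type*} [MeasurableSpace Ω] (S : ℝ≥0 → Ω → ℝ) (Q : Measure Ω) :
    Prop where
  measurable : ∀ t, Measurable (S t)
  zero : ∀ᵐ ω ∂Q, S 0 ω = 0
  indep : HasIndepIncrements S Q
  stationary : ∀ s t, IdentDistrib (fun ω => S (s + t) ω - S s ω) (S t) Q Q
  mono : ∀ᵐ ω ∂Q, Monotone fun t => S t ω
  right_cont : ∀ᵐ ω ∂Q, ∀ t, ContinuousWithinAt (fun s => S s ω) (Ici t) t

/-- `φ` is the Laplace exponent of `S`: `E exp(-l S_t) = exp(-t φ(l))` for `t ≥ 0`, `l > 0`. -/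
def HasLaplaceExponent {Ω : Type*} [MeasurableSpace Ω] (S : ℝ≥0 → Ω → ℝ) (Q : Measure Ω)
    (φ : ℝ → ℝ) : Prop :=
  ∀ (t : ℝ≥0) (l : ℝ), 0 < l →
    ∫ ω, Real.exp (-(l * S t ω)) ∂Q = Real.exp (-((t : ℝ) * φ l))

/-- There is no drift (and no killing): `φ(l) = ∫_{(0,∞)} (1 - e^{-l s}) ν(ds)` for a measure `ν`
on `(0,∞)` with `∫ (1 ∧ s) ν(ds) < ∞`. -/
def IsDriftless (φ : ℝ → ℝ) : Prop :=
  ∃ ν : Measure ℝ, ν (Iic 0) = 0 ∧ ∫⁻ s, ENNReal.ofReal (min 1 s) ∂ν < ∞ ∧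
    ∀ l : ℝ, 0 < l → φ l = ∫ s, (1 - Real.exp (-(l * s))) ∂ν

/-- The function `r ↦ P(S_r ≥ t)`, extended by its value at `0` to `r < 0`. -/
def passageProb {Ω : Type*} [MeasurableSpace Ω] (S : ℝ≥0 → Ω → ℝ) (Q : Measure Ω) (t r : ℝ) : ℝ :=
  Q.real {ω | t ≤ S r.toNNReal ω}

theorem passageProb_mono {Ω : Type*} [MeasurableSpace Ω] {S : ℝ≥0 → Ω → ℝ} {Q : Measure Ω}
    [IsProbabilityMeasure Q] (hS : IsSubordinator S Q) (t : ℝ) :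
    Monotone (passageProb S Q t) := by
  intro a b hab
  refine ENNReal.toReal_mono (measure_ne_top _ _) (measure_mono_ae ?_)
  filter_upwards [hS.mono] with ω hω h
  exact le_trans (show t ≤ S a.toNNReal ω from h) (hω (Real.toNNReal_le_toNNReal hab))

/-- The Lebesgue–Stieltjes measure `d_r P(S_r ≥ t)` on `(0,∞)`. -/
def passageMeasure {Ω : Type*} [MeasurableSpace Ω] {S : ℝ≥0 → Ω → ℝ} {Q : Measure Ω}
    [IsProbabilityMeasure Q] (hS : IsSubordinator S Q) (t : ℝ) : Measure ℝ :=
  (passageProb_mono hS t).stieltjesFunction.measure.restrict (Ioi 0)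

/-- The fundamental solution `p(t,x,y) = ∫₀^∞ q(r,x,y) d_r P(S_r ≥ t)`, with values in `[0,∞]`
(it may be infinite for `x = y`). -/
def fundSol {M Ω : Type*} [MeasurableSpace Ω] {S : ℝ≥0 → Ω → ℝ} {Q : Measure Ω}
    [IsProbabilityMeasure Q] (hS : IsSubordinator S Q) (q : ℝ → M → M → ℝ)
    (t : ℝ) (x y : M) : ℝ≥0∞ :=
  ∫⁻ r, ENNReal.ofReal (q r x y) ∂(passageMeasure hS t)

/-! ### The diffusion and its heat kernel -/

/-- A conservative diffusion `(X, (P_x))` on `M`: a strong Markov process with continuous sample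
paths and infinite lifetime (`X_t` is `M`-valued for all `t`). Strong Markov property: for every
stopping time `τ`, `P_x(X_{τ+s} ∈ B | ℱ_τ) = P_{X_τ}(X_s ∈ B)` on `{τ < ∞}`. -/
structure IsConservativeDiffusion {M Ω : Type*} [MetricSpace M] [MeasurableSpace M]
    {mΩ : MeasurableSpace Ω} (ℱ : Filtration ℝ≥0 mΩ) (X : ℝ≥0 → Ω → M) (P : M → Measure Ω) :
    Prop where
  prob : ∀ x, IsProbabilityMeasure (P x)
  adapted : Adapted ℱ X
  start : ∀ x, ∀ᵐ ω ∂(P x), X 0 ω = x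
  continuous : ∀ x, ∀ᵐ ω ∂(P x), Continuous fun t => X t ω
  measurable_law : ∀ (t : ℝ≥0) (B : Set M), MeasurableSet B → Measurable fun x => P x (X t ⁻¹' B)
  strong_markov : ∀ (τ : Ω → WithTop ℝ≥0) (hτ : IsStoppingTime ℱ τ) (A : Set Ω),
    MeasurableSet[hτ.measurableSpace] A → (∀ ω ∈ A, τ ω ≠ ⊤) →
    ∀ (x : M) (s : ℝ≥0) (B : Set M), MeasurableSet B →
      P x (A ∩ {ω | X ((τ ω).untopA + s) ω ∈ B})
        = ∫⁻ ω in A, P (X (τ ω).untopA ω) (X s ⁻¹' B) ∂(P x)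

/-- `q(t,x,y)`, `t > 0`, is a (jointly measurable, non-negative) transition density of `X` with
respect to `μ`. -/
structure IsHeatKernel {M Ω : Type*} [MeasurableSpace M] [MeasurableSpace Ω]
    (μ : Measure M) (X : ℝ≥0 → Ω → M) (P : M → Measure Ω) (q : ℝ → M → M → ℝ) : Prop where
  measurable : Measurable fun z : ℝ × M × M => q z.1 z.2.1 z.2.2
  nonneg : ∀ t x y, 0 < t → 0 ≤ q t x y
  density : ∀ (t : ℝ≥0) (x : M) (B : Set M), 0 < t → MeasurableSet B →
    P x (X t ⁻¹' B) = ∫⁻ y in B, ENNReal.ofReal (q t x y) ∂μ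

/-- `Φ : [0,∞) → [0,∞)` is strictly increasing with `Φ(0) = 0` and has the weak scaling property
with `(a₁, a₂)`. -/
structure IsScale (a₁ a₂ : ℝ) (Φ : ℝ → ℝ) : Prop where
  zero : Φ 0 = 0
  strictMono : StrictMonoOn Φ (Ici 0)
  scaling : WeakScaling a₁ a₂ Φ

/-- `m(t,r)` is positive for `t, r > 0`, non-increasing in `t`, satisfies
`t / m(t,r) ≃ Φ(r / m(t,r))`, and, by convention, `m(t,0) = 0`. -/
structure IsDiffusionExponent (Φ : ℝ → ℝ) (m : ℝ → ℝ → ℝ) : Prop where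
  pos : ∀ t r, 0 < t → 0 < r → 0 < m t r
  zero : ∀ t, 0 < t → m t 0 = 0
  anti : ∀ r, 0 < r → AntitoneOn (fun t => m t r) (Ioi 0)
  scale : ∃ c₁ c₂ : ℝ, 0 < c₁ ∧ 0 < c₂ ∧ ∀ t r, 0 < t → 0 < r →
    c₁ * Φ (r / m t r) ≤ t / m t r ∧ t / m t r ≤ c₂ * Φ (r / m t r)

/-- `n(t,r)` is positive for `t, r > 0`, non-increasing in `t`, and satisfies
`1 / φ(n(t,r)/t) ≃ Φ(r / n(t,r))`. -/
structure IsFractionalExponent (φ Φ : ℝ → ℝ) (n : ℝ → ℝ → ℝ) : Prop where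
  pos : ∀ t r, 0 < t → 0 < r → 0 < n t r
  anti : ∀ r, 0 < r → AntitoneOn (fun t => n t r) (Ioi 0)
  scale : ∃ c₁ c₂ : ℝ, 0 < c₁ ∧ 0 < c₂ ∧ ∀ t r, 0 < t → 0 < r →
    c₁ * Φ (r / n t r) ≤ 1 / φ (n t r / t) ∧ 1 / φ (n t r / t) ≤ c₂ * Φ (r / n t r)

/-- The two-sided estimate `q(t,x,y) ≍ V(x,Φ⁻¹(t))⁻¹ exp(-m(t,d(x,y)))`. -/
def SubGaussianEstimate {M : Type*} [MetricSpace M] [MeasurableSpace M] (μ : Measure M)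
    (Φ : ℝ → ℝ) (m : ℝ → ℝ → ℝ) (q : ℝ → M → M → ℝ) : Prop :=
  ∃ C₁ c₁ C₂ c₂ : ℝ, 0 < C₁ ∧ 0 < c₁ ∧ 0 < C₂ ∧ 0 < c₂ ∧ ∀ (t : ℝ) (x y : M), 0 < t →
    C₁ / vol μ x (inv Φ t) * Real.exp (-(c₁ * m t (dist x y))) ≤ q t x y ∧
    q t x y ≤ C₂ / vol μ x (inv Φ t) * Real.exp (-(c₂ * m t (dist x y)))

end

end TimeFractional

namespace TimeFractional

open MeasureTheory ProbabilityTheory Set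
open scoped ENNReal NNReal

/-! ### Scaling -/

section Scaling

variable {c₁ c₂ a₁ a₂ : ℝ} {Ψ : ℝ → ℝ}

/-! The measure `d_r P(S_r ≥ t)` is the law of the first passage of `S` over level `t`, so `p`
averages `q(r,x,y)` over a random time whose natural scale is `1/φ(1/t)`. Two facts about this law
suffice, both derived from the Laplace transform. At small times it is comparable with `φ(1/t) dr`
in a coarse sense: mass of `(0,r]` at most, and of `(r,Kr]` at least, a constant times `rφ(1/t)`
(`passageMeasure_Ioc_zero_le`, `exists_le_passageMeasure_Ioc`). At late times `s = n/φ(n/t)` it has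
tail `e^{-cn}`, and still charges `(s,Ks]` with mass at least `e^{-Cn}`
(`exists_passageMeasure_Ioi_le_exp`, `exists_exp_neg_le_passageMeasure_Ioc`). No density is needed:
integrals of a doubling profile against a measure controlled on dyadic-type blocks are compared with
Lebesgue integrals by Tonelli.

On the side of `q`, the exponent `m(r,d)` is bounded once `r ≥ Φ(d)`, while for `r ≤ Φ(d)` it grows
like a power of `Φ(d)/r` and absorbs the polynomial growth of `1/V(x,Φ⁻¹(r))`
(`profile_mul_exp_le`). If `Φ(d)φ(1/t) ≤ 1`, times above `Φ(d)` therefore produce the integral in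
(i), and the remaining times contribute no more than one block of it.

If `Φ(d)φ(1/t) ≥ 1`, the diffusion pays `m(r,d)` to travel far in time `r`, and the subordinator
pays to stay below `t` until time `r`. At `r = n/φ(n/t)` the second cost is of order `n`; the first
is too exactly when `r/n = 1/φ(n/t)` is comparable with `Φ(d/n)`, which is the equation defining
`n(t,d)`. Since `α₁ > 1`, approximate solutions of such equations agree up to constants
(`exponent_le_mul`), so any admissible `n` will do, and volume factors are absorbed by the
exponentials. -/

theorem WeakScalingWith.le_mul (h : WeakScalingWith c₁ c₂ a₁ a₂ Ψ) {r R : ℝ} (hr : 0 < r)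
    (hrR : r ≤ R) : Ψ R ≤ c₂ * (R / r) ^ a₂ * Ψ r :=
  (div_le_iff₀ (h.pos r hr)).1 (h.upper r R hr hrR)

theorem WeakScalingWith.mul_le (h : WeakScalingWith c₁ c₂ a₁ a₂ Ψ) {r R : ℝ} (hr : 0 < r)
    (hrR : r ≤ R) : c₁ * (R / r) ^ a₁ * Ψ r ≤ Ψ R :=
  (le_div_iff₀ (h.pos r hr)).1 (h.lower r R hr hrR)

theorem IsScale.mono {Φ : ℝ → ℝ} (h : IsScale a₁ a₂ Φ) : MonotoneOn Φ (Ici 0) :=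
  h.strictMono.monotoneOn

theorem IsScale.pos {Φ : ℝ → ℝ} (h : IsScale a₁ a₂ Φ) {r : ℝ} (hr : 0 < r) : 0 < Φ r := by
  have := h.strictMono (self_mem_Ici) hr.le hr
  rwa [h.zero] at this

/-- A power bound `x ^ a ≤ b` with `a > 0` bounds `x`. -/
theorem le_rpow_inv_of_rpow_le {x a b : ℝ} (hx : 0 ≤ x) (ha : 0 < a) (h : x ^ a ≤ b) :
    x ≤ b ^ a⁻¹ :=
  (Real.le_rpow_inv_iff_of_pos hx ((Real.rpow_nonneg hx a).trans h) ha).2 h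

theorem IsScale.exists_ge {Φ : ℝ → ℝ} (h : IsScale a₁ a₂ Φ) (t : ℝ) : ∃ s, 0 < s ∧ t ≤ Φ s := by
  obtain ⟨ha, -, c₁, c₂, hc₁, -, hs⟩ := h.scaling
  have ht := (tendsto_rpow_atTop ha).eventually_ge_atTop (t / (c₁ * Φ 1))
  obtain ⟨s, hs1, hts⟩ := ((Filter.eventually_ge_atTop (1 : ℝ)).and ht).exists
  refine ⟨s, by linarith, ?_⟩
  have := hs.mul_le one_pos hs1
  rw [div_le_iff₀ (mul_pos hc₁ (h.pos one_pos))] at hts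
  rw [div_one] at this
  linarith

theorem IsScale.exists_lt {Φ : ℝ → ℝ} (h : IsScale a₁ a₂ Φ) {t : ℝ} (ht : 0 < t) :
    ∃ s, 0 < s ∧ Φ s < t := by
  obtain ⟨ha, -, c₁, c₂, hc₁, -, hs⟩ := h.scaling
  have hpos := h.pos one_pos
  have ht := (tendsto_rpow_atTop ha).eventually_gt_atTop (Φ 1 / (c₁ * t))
  obtain ⟨s, hs1, hts⟩ := ((Filter.eventually_ge_atTop (1 : ℝ)).and ht).exists
  have hs0 : 0 < s := by linarith
  refine ⟨1 / s, by positivity, ?_⟩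
  have := hs.mul_le (r := 1 / s) (R := 1) (by positivity) (by rw [div_le_one hs0]; exact hs1)
  rw [one_div_one_div] at this
  rw [div_lt_iff₀ (by positivity)] at hts
  by_contra! hcon
  have : c₁ * s ^ a₁ * t ≤ c₁ * s ^ a₁ * Φ (1 / s) := by gcongr
  nlinarith

theorem inv_nonneg (Φ : ℝ → ℝ) (t : ℝ) : 0 ≤ inv Φ t :=
  Real.sInf_nonneg fun _ hs => hs.1

/-- `Φ` may jump, so its value at `Φ⁻¹(t)` may lie on either side of `t`. It is controlled only
strictly below `Φ⁻¹(t)`, here, and strictly above, in `IsScale.le_of_inv_lt`. -/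
theorem lt_of_lt_inv {Φ : ℝ → ℝ} {s t : ℝ} (hs : 0 ≤ s) (h : s < inv Φ t) : Φ s < t := by
  by_contra! hcon
  exact absurd (csInf_le ⟨0, fun _ hx => hx.1⟩ (show s ∈ {s | 0 ≤ s ∧ t ≤ Φ s} from ⟨hs, hcon⟩))
    (not_le.2 h)

theorem IsScale.le_of_inv_lt {Φ : ℝ → ℝ} (h : IsScale a₁ a₂ Φ) {s t : ℝ} (hs : inv Φ t < s) :
    t ≤ Φ s := by
  obtain ⟨u, hu, htu⟩ := h.exists_ge t
  have hne : {s : ℝ | 0 ≤ s ∧ t ≤ Φ s}.Nonempty := ⟨u, hu.le, htu⟩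
  obtain ⟨v, hv, hvs⟩ := exists_lt_of_csInf_lt hne hs
  exact hv.2.trans (h.mono hv.1 (hv.1.trans hvs.le) hvs.le)

theorem IsScale.inv_pos {Φ : ℝ → ℝ} (h : IsScale a₁ a₂ Φ) {t : ℝ} (ht : 0 < t) : 0 < inv Φ t := by
  obtain ⟨s, hs, hst⟩ := h.exists_lt ht
  refine hs.trans_le ?_
  by_contra! hcon
  exact absurd (h.le_of_inv_lt hcon) (not_le.2 hst)

theorem IsScale.inv_mono {Φ : ℝ → ℝ} (h : IsScale a₁ a₂ Φ) : Monotone (inv Φ) := by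
  intro t u htu
  obtain ⟨s, hs, hus⟩ := h.exists_ge u
  exact csInf_le_csInf ⟨0, fun _ hx => hx.1⟩ ⟨s, hs.le, hus⟩ fun x hx => ⟨hx.1, htu.trans hx.2⟩

/-- The inverse of a scale function grows at most polynomially. -/
theorem IsScale.inv_scaling {Φ : ℝ → ℝ} (h : IsScale a₁ a₂ Φ) :
    ∃ C, 0 < C ∧ ∀ r R, 0 < r → r ≤ R → inv Φ R ≤ C * (R / r) ^ a₁⁻¹ * inv Φ r := by
  obtain ⟨ha, -, c₁, c₂, hc₁, -, hs⟩ := h.scaling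
  -- The 4 is two factors of 2: scaling is applied between `2Φ⁻¹(r)` and `Φ⁻¹(R)/2`, where `Φ ≥ r`
  -- and `Φ ≤ R` whatever the jumps. The 1 in the maximum covers the case where these points come in
  -- the wrong order.
  refine ⟨4 * max 1 (c₁⁻¹ ^ a₁⁻¹), by positivity, fun r R hr hrR => ?_⟩
  have hpr := h.inv_pos hr
  have hpR := h.inv_pos (hr.trans_le hrR)
  have hone : 1 ≤ (R / r) ^ a₁⁻¹ := Real.one_le_rpow (by rwa [one_le_div hr]) (by positivity)
  rcases le_total (inv Φ R / 2) (2 * inv Φ r) with hle | hle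
  · calc inv Φ R ≤ 4 * 1 * 1 * inv Φ r := by linarith
      _ ≤ _ := by gcongr; exact le_max_left _ _
  · have hu : Φ (inv Φ R / 2) ≤ R := (lt_of_lt_inv (by linarith) (by linarith)).le
    have hl : r ≤ Φ (2 * inv Φ r) := h.le_of_inv_lt (by linarith)
    have key := hs.mul_le (by linarith) hle
    set v := inv Φ R / 2 / (2 * inv Φ r) with hv
    have hv0 : 0 < v := by positivity
    have h1 : v ^ a₁ ≤ c₁⁻¹ * (R / r) := by
      have h2 : c₁ * v ^ a₁ * r ≤ R :=
        (mul_le_mul_of_nonneg_left hl (by positivity)).trans (key.trans hu)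
      rw [inv_mul_eq_div, div_div, mul_comm r, ← div_div, le_div_iff₀ hr, ← inv_mul_eq_div,
        inv_mul_eq_div, le_div_iff₀ hc₁] at *
      linarith
    have h3 := le_rpow_inv_of_rpow_le hv0.le ha h1
    rw [Real.mul_rpow (by positivity) (div_nonneg (hr.le.trans hrR) hr.le)] at h3
    calc inv Φ R = 4 * v * inv Φ r := by rw [hv]; field_simp; ring
      _ ≤ 4 * (c₁⁻¹ ^ a₁⁻¹ * (R / r) ^ a₁⁻¹) * inv Φ r := by gcongr
      _ = 4 * c₁⁻¹ ^ a₁⁻¹ * (R / r) ^ a₁⁻¹ * inv Φ r := by ring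
      _ ≤ _ := by gcongr; exact le_max_right _ _

end Scaling

/-! ### The on-diagonal profile -/

section Profile

variable {M : Type*} [MetricSpace M] [MeasurableSpace M] {μ : Measure M} {a₁ a₂ d₁ d₂ : ℝ}
  {Φ : ℝ → ℝ}

/-- The on-diagonal profile `r ↦ 1 / V(x, Φ⁻¹(r))`. -/
noncomputable def profile (μ : Measure M) (Φ : ℝ → ℝ) (x : M) (r : ℝ) : ℝ :=
  1 / vol μ x (inv Φ r)

theorem vol_mono (hV : UniformWeakScaling d₁ d₂ (vol μ)) (x : M) : MonotoneOn (vol μ x) (Ici 0) := by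
  obtain ⟨-, -, c₁, c₂, -, -, h⟩ := hV
  intro r hr R hR hrR
  rcases (mem_Ici.1 hr).eq_or_lt with rfl | hr'
  · simp [vol]
  · exact (h x).mono hr' (hr'.trans_le hrR) hrR

theorem vol_pos (hV : UniformWeakScaling d₁ d₂ (vol μ)) (x : M) {r : ℝ} (hr : 0 < r) :
    0 < vol μ x r := by
  obtain ⟨-, -, c₁, c₂, -, -, h⟩ := hV
  exact (h x).pos r hr

theorem profile_nonneg (x : M) (r : ℝ) : 0 ≤ profile μ Φ x r :=
  one_div_nonneg.2 measureReal_nonneg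

theorem profile_anti (hV : UniformWeakScaling d₁ d₂ (vol μ)) (hΦ : IsScale a₁ a₂ Φ) (x : M)
    {r R : ℝ} (hr : 0 < r) (hrR : r ≤ R) : profile μ Φ x R ≤ profile μ Φ x r :=
  one_div_le_one_div_of_le (vol_pos hV x (hΦ.inv_pos hr))
    (vol_mono hV x (inv_nonneg _ _) (inv_nonneg _ _) (hΦ.inv_mono hrR))

theorem measurable_profile (hV : UniformWeakScaling d₁ d₂ (vol μ)) (hΦ : IsScale a₁ a₂ Φ) (x : M) :
    Measurable (profile μ Φ x) := by
  have : Monotone fun r => vol μ x (inv Φ r) := fun r R hrR =>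
    vol_mono hV x (inv_nonneg _ _) (inv_nonneg _ _) (hΦ.inv_mono hrR)
  exact measurable_const.div this.measurable

/-- The profile decays at most polynomially, uniformly in the base point. -/
theorem profile_scaling (hV : UniformWeakScaling d₁ d₂ (vol μ)) (hΦ : IsScale a₁ a₂ Φ) :
    ∃ C p : ℝ, 0 < C ∧ 0 < p ∧ ∀ (x : M) (r R : ℝ), 0 < r → r ≤ R →
      profile μ Φ x r ≤ C * (R / r) ^ p * profile μ Φ x R := by
  obtain ⟨C, hC, hinv⟩ := hΦ.inv_scaling
  have ha := hΦ.scaling.1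
  have hVm := hV
  obtain ⟨hd₁, hd, c₁, c₂, hc₁, hc₂, hs⟩ := hV
  have hd₂ : 0 < d₂ := hd₁.trans_le hd
  refine ⟨c₂ * C ^ d₂, a₁⁻¹ * d₂, by positivity, by positivity, fun x r R hr hrR => ?_⟩
  have hpr := hΦ.inv_pos hr
  have hpR := hΦ.inv_pos (hr.trans_le hrR)
  have hR : 0 < R := hr.trans_le hrR
  have hv := (hs x).pos _ hpr
  have hv' := (hs x).pos _ hpR
  have h1 := (hs x).le_mul hpr (hΦ.inv_mono hrR)
  have h2 : inv Φ R / inv Φ r ≤ C * (R / r) ^ a₁⁻¹ := by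
    rw [div_le_iff₀ hpr]; exact hinv r R hr hrR
  have h3 : (inv Φ R / inv Φ r) ^ d₂ ≤ C ^ d₂ * (R / r) ^ (a₁⁻¹ * d₂) := by
    rw [Real.rpow_mul (by positivity), ← Real.mul_rpow hC.le (by positivity)]
    exact Real.rpow_le_rpow (by positivity) h2 hd₂.le
  unfold profile
  rw [div_le_iff₀ hv, mul_one_div, div_mul_eq_mul_div, le_div_iff₀ hv', one_mul]
  refine h1.trans ?_
  rw [mul_assoc c₂ (C ^ d₂)]
  gcongr

end Profile

/-! ### Comparison of exponents -/

section Exponents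

/-- Approximate sub- and supersolutions of `r / n = Φ (d / n)` are ordered up to a constant. -/
theorem exponent_le_mul {c₁ c₂ a₁ a₂ : ℝ} {Φ : ℝ → ℝ} (hs : WeakScalingWith c₁ c₂ a₁ a₂ Φ)
    (hc₁ : 0 < c₁) (ha : 1 < a₁) {A : ℝ} (B : ℝ) (hA : 0 < A) :
    ∃ C, 0 < C ∧ ∀ r d m n, 0 < r → 0 < d → 0 < m → 0 < n →
      A * Φ (d / m) ≤ r / m → r / n ≤ B * Φ (d / n) → n ≤ C * m := by
  refine ⟨max 1 ((B / (A * c₁)) ^ (a₁ - 1)⁻¹), by positivity,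
    fun r d m n hr hd hm hn h1 h2 => ?_⟩
  -- For `m ≤ n`, passing from `d/n` to `d/m` multiplies `Φ` by at least `c₁(n/m)^{a₁}`, whereas
  -- `r/m` is only `n/m` times `r/n`. The surplus `(n/m)^{a₁-1}` is thus at most `B/(A c₁)`.
  rcases le_total n m with hnm | hmn
  · calc n ≤ 1 * m := by linarith
      _ ≤ _ := by gcongr; exact le_max_left _ _
  have hdn : 0 < d / n := by positivity
  have key := hs.mul_le hdn (div_le_div_of_nonneg_left hd.le hm hmn)
  have e : d / m / (d / n) = n / m := by field_simp
  rw [e] at key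
  have hx : 0 < n / m := by positivity
  have hpos := hs.pos _ hdn
  have e2 : (n / m) ^ a₁ = (n / m) ^ (a₁ - 1) * (n / m) := by
    rw [← Real.rpow_add_one hx.ne']; ring_nf
  have h3 : (n / m) ^ (a₁ - 1) ≤ B / (A * c₁) := by
    rw [le_div_iff₀ (by positivity)]
    have h4 : A * (c₁ * (n / m) ^ a₁ * Φ (d / n)) ≤ B * Φ (d / n) * (n / m) :=
      calc A * (c₁ * (n / m) ^ a₁ * Φ (d / n)) ≤ A * Φ (d / m) := by gcongr
        _ ≤ r / m := h1
        _ = r / n * (n / m) := by field_simp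
        _ ≤ _ := by gcongr
    rw [e2] at h4
    have h5 : 0 < Φ (d / n) * (n / m) := by positivity
    refine le_of_mul_le_mul_right ?_ h5
    linarith
  have h6 := le_rpow_inv_of_rpow_le hx.le (by linarith) h3
  rw [div_le_iff₀ hm] at h6
  refine h6.trans ?_
  gcongr
  exact le_max_right _ _

variable {α₁ α₂ : ℝ} {Φ : ℝ → ℝ} {m : ℝ → ℝ → ℝ}

theorem IsDiffusionExponent.nonneg (hm : IsDiffusionExponent Φ m) {t r : ℝ} (ht : 0 < t)
    (hr : 0 ≤ r) : 0 ≤ m t r := by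
  rcases hr.eq_or_lt with rfl | hr
  · exact (hm.zero t ht).ge
  · exact (hm.pos t r ht hr).le

theorem IsDiffusionExponent.le_of_le (hm : IsDiffusionExponent Φ m) {s t r : ℝ} (hs : 0 < s)
    (hst : s ≤ t) (hr : 0 ≤ r) : m t r ≤ m s r := by
  rcases hr.eq_or_lt with rfl | hr
  · rw [hm.zero s hs, hm.zero t (hs.trans_le hst)]
  · exact hm.anti r hr hs (hs.trans_le hst) hst

/-- `m(t,r)` is bounded on `t ≥ Φ(r)`. -/
theorem IsDiffusionExponent.bounded (hm : IsDiffusionExponent Φ m) (hΦ : IsScale α₁ α₂ Φ)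
    (hα : 1 < α₁) : ∃ C, 0 < C ∧ ∀ t r, 0 < t → 0 ≤ r → Φ r ≤ t → m t r ≤ C := by
  obtain ⟨-, -, c₁, c₂, hc₁, -, hs⟩ := hΦ.scaling
  obtain ⟨k₁, k₂, hk₁, hk₂, hk⟩ := hm.scale
  obtain ⟨C, hC, h⟩ := exponent_le_mul hs hc₁ hα k₂ one_pos
  refine ⟨C, hC, fun t r ht hr hrt => ?_⟩
  rcases hr.eq_or_lt with rfl | hr
  · rw [hm.zero t ht]; exact hC.le
  have hΦr := hΦ.pos hr
  refine (hm.le_of_le hΦr hrt hr.le).trans ?_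
  -- At `t = Φ(r)` the value 1 solves the defining equation exactly.
  have := h (Φ r) r 1 (m (Φ r) r) hΦr hr one_pos (hm.pos _ _ hΦr hr) (by simp)
    (hk _ _ hΦr hr).2
  linarith

/-- `m(t,r)` grows at least like a power of `Φ(r) / t` on `t ≤ Φ(r)`. -/
theorem IsDiffusionExponent.power_le (hm : IsDiffusionExponent Φ m) (hΦ : IsScale α₁ α₂ Φ)
    (hα : 1 < α₁) : ∃ c γ : ℝ, 0 < c ∧ 0 < γ ∧ ∀ t r, 0 < t → 0 < r → t ≤ Φ r →
      c * (Φ r / t) ^ γ ≤ m t r := by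
  obtain ⟨-, hαα, c₁, c₂, hc₁, hc₂, hs⟩ := hΦ.scaling
  obtain ⟨k₁, k₂, hk₁, hk₂, hk⟩ := hm.scale
  obtain ⟨C, hC, h⟩ := exponent_le_mul hs hc₁ hα c₂ hk₁
  have hα₂ : 0 < α₂ - 1 := by linarith
  refine ⟨C⁻¹, (α₂ - 1)⁻¹, by positivity, by positivity, fun t r ht hr htr => ?_⟩
  have hu : 0 < Φ r / t := div_pos (hΦ.pos hr) ht
  -- Chosen so that `n^{α₂} = (Φ(r)/t) n`; the upper scaling of `Φ` from `r/n` to `r` then reads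
  -- `t/n ≤ c₂Φ(r/n)`, so `n` is bounded by a multiple of `m`.
  set n := (Φ r / t) ^ (α₂ - 1)⁻¹ with hn
  have hn0 : 0 < n := by positivity
  have hn1 : 1 ≤ n := Real.one_le_rpow (by rwa [one_le_div ht]) (by positivity)
  rw [inv_mul_le_iff₀ hC]
  refine h t r _ n ht hr (hm.pos t r ht hr) hn0 (hk t r ht hr).1 ?_
  have h1 := hs.le_mul (r := r / n) (R := r) (by positivity) (div_le_self hr.le hn1)
  have e : r / (r / n) = n := by field_simp
  have e2 : n ^ α₂ = Φ r / t * n := by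
    have : n ^ (α₂ - 1) = Φ r / t := by
      rw [hn, ← Real.rpow_mul hu.le, inv_mul_cancel₀ hα₂.ne', Real.rpow_one]
    rw [← this, ← Real.rpow_add_one hn0.ne']; ring_nf
  rw [e, e2] at h1
  have h2 : Φ r * 1 ≤ Φ r * (c₂ * Φ (r / n) * n / t) := by
    calc Φ r * 1 ≤ _ := by simpa using h1
      _ = _ := by ring
  have h3 := le_of_mul_le_mul_left h2 (hΦ.pos hr)
  rw [le_div_iff₀ ht] at h3
  rw [div_le_iff₀ hn0]
  linarith

/-- Powers are dominated by stretched exponentials. -/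
theorem rpow_mul_exp_neg_le {c γ p : ℝ} (hc : 0 < c) (hγ : 0 < γ) (hp : 0 < p) :
    ∃ C, 0 < C ∧ ∀ u : ℝ, 0 < u → u ^ p * Real.exp (-(c * u ^ γ)) ≤ C := by
  -- With `γk > p`, the `k`-th Taylor term of the exponential dominates `u^p` for `u ≥ 1`; the
  -- summand 1 in the constant covers `u ≤ 1`.
  obtain ⟨k, hk⟩ := exists_nat_gt (p / γ)
  have hk0 : 0 < (k : ℝ) := (by positivity : (0:ℝ) < p / γ).trans hk
  refine ⟨1 + k.factorial / c ^ k, by positivity, fun u hu => ?_⟩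
  have h1 := Real.pow_div_factorial_le_exp (c * u ^ γ) (by positivity) k
  have h2 : u ^ p ≤ 1 + (u ^ γ) ^ k := by
    rw [← Real.rpow_natCast, ← Real.rpow_mul hu.le]
    rcases le_total u 1 with hu1 | hu1
    · have := Real.rpow_le_one hu.le hu1 hp.le
      have : 0 < u ^ (γ * k) := by positivity
      linarith
    · have := Real.rpow_le_rpow_of_exponent_le hu1 (x := u) (y := p) (z := γ * k)
        (by rw [div_lt_iff₀ hγ] at hk; linarith)
      linarith
  have h3 : (u ^ γ) ^ k ≤ k.factorial / c ^ k * Real.exp (c * u ^ γ) := by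
    rw [mul_pow, div_le_iff₀ (by positivity)] at h1
    rw [div_mul_eq_mul_div, le_div_iff₀ (by positivity)]
    linarith
  have h4 : 1 ≤ Real.exp (c * u ^ γ) := Real.one_le_exp (by positivity)
  rw [Real.exp_neg, ← div_eq_mul_inv, div_le_iff₀ (Real.exp_pos _)]
  linarith

/-- On `t ≤ Φ(d(x,y))` the exponential factor absorbs the growth of the profile. -/
theorem profile_mul_exp_le {M : Type*} [MetricSpace M] [MeasurableSpace M] {μ : Measure M}
    {d₁ d₂ : ℝ} (hV : UniformWeakScaling d₁ d₂ (vol μ)) (hm : IsDiffusionExponent Φ m)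
    (hΦ : IsScale α₁ α₂ Φ) (hα : 1 < α₁) {c : ℝ} (hc : 0 < c) :
    ∃ C, 0 < C ∧ ∀ (x : M) (t r : ℝ), 0 < t → 0 < r → t ≤ Φ r →
      profile μ Φ x t * Real.exp (-(c * m t r)) ≤ C * profile μ Φ x (Φ r) := by
  obtain ⟨A, p, hA, hp, hw⟩ := profile_scaling hV hΦ
  obtain ⟨b, γ, hb, hγ, hmb⟩ := hm.power_le hΦ hα
  obtain ⟨C, hC, hCb⟩ := rpow_mul_exp_neg_le (mul_pos hc hb) hγ hp
  refine ⟨A * C, by positivity, fun x t r ht hr htr => ?_⟩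
  have hu : 0 < Φ r / t := div_pos (hΦ.pos hr) ht
  have h0 := profile_nonneg (μ := μ) (Φ := Φ) x (Φ r)
  calc profile μ Φ x t * Real.exp (-(c * m t r))
      ≤ (A * (Φ r / t) ^ p * profile μ Φ x (Φ r)) * Real.exp (-(c * b * (Φ r / t) ^ γ)) := by
        have h2 : c * b * (Φ r / t) ^ γ ≤ c * m t r := by
          rw [mul_assoc]
          exact mul_le_mul_of_nonneg_left (hmb t r ht hr htr) hc.le
        exact mul_le_mul (hw x t (Φ r) ht htr) (Real.exp_le_exp.2 (neg_le_neg h2))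
          (Real.exp_pos _).le (by positivity)
    _ = A * ((Φ r / t) ^ p * Real.exp (-(c * b * (Φ r / t) ^ γ))) * profile μ Φ x (Φ r) := by ring
    _ ≤ _ := by gcongr; exact hCb _ hu

end Exponents

/-! ### The fractional exponent -/

section FractionalExponent

variable {α₁ α₂ β₁ β₂ : ℝ} {Φ φ : ℝ → ℝ}

/-- As `n` grows, `Φ(r/n)` decays with exponent at least `α₁` and `φ(n/t)` grows with exponent at
most `β₂`. The product, though not monotone in `n`, decays like a power when `β₂ < α₁`, which makes
the level 1 that defines `n(t,r)` meaningful. -/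
theorem IsScale.div_mul_scaling (hΦ : IsScale α₁ α₂ Φ) (hφ : WeakScaling β₁ β₂ φ) :
    ∃ C, 0 < C ∧ ∀ t r k n, 0 < t → 0 < r → 0 < k → k ≤ n →
      (n / k) ^ (α₁ - β₂) * (Φ (r / n) * φ (n / t)) ≤ C * (Φ (r / k) * φ (k / t)) := by
  obtain ⟨-, -, c₁, c₂, hc₁, -, hs⟩ := hΦ.scaling
  obtain ⟨-, -, b₁, b₂, -, hb₂, hsφ⟩ := hφ
  refine ⟨b₂ / c₁, by positivity, fun t r k n ht hr hk hkn => ?_⟩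
  have hn : 0 < n := hk.trans_le hkn
  have hx : 0 < n / k := by positivity
  have h1 := hs.mul_le (r := r / n) (R := r / k) (by positivity) (by gcongr)
  have h2 := hsφ.le_mul (r := k / t) (R := n / t) (by positivity) (by gcongr)
  have e1 : r / k / (r / n) = n / k := by field_simp
  have e2 : n / t / (k / t) = n / k := by field_simp
  rw [e1] at h1
  rw [e2] at h2
  have p1 := hΦ.pos (div_pos hr hn)
  have p2 := hsφ.pos _ (div_pos hk ht)
  have p3 := hsφ.pos _ (div_pos hn ht)
  have p4 := hΦ.pos (div_pos hr hk)
  rw [Real.rpow_sub hx, div_mul_eq_mul_div, div_mul_eq_mul_div, div_le_div_iff₀ (by positivity) hc₁]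
  calc (n / k) ^ α₁ * (Φ (r / n) * φ (n / t)) * c₁
      = (c₁ * (n / k) ^ α₁ * Φ (r / n)) * φ (n / t) := by ring
    _ ≤ Φ (r / k) * (b₂ * (n / k) ^ β₂ * φ (k / t)) := by gcongr
    _ = _ := by ring

/-- An exponent `n(t,r)` with `1 / φ(n(t,r)/t) ≃ Φ(r / n(t,r))` exists. -/
theorem exists_isFractionalExponent (hΦ : IsScale α₁ α₂ Φ) (hφ : WeakScaling β₁ β₂ φ)
    (hαβ : β₂ < α₁) : ∃ n, IsFractionalExponent φ Φ n := by
  obtain ⟨C, hC, hg⟩ := hΦ.div_mul_scaling hφ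
  obtain ⟨-, -, c₁, c₂, hc₁, hc₂, hs⟩ := hΦ.scaling
  obtain ⟨-, -, b₁, b₂, -, hb₂, hsφ⟩ := hφ
  have hδ : 0 < α₁ - β₂ := by linarith
  -- An exact root need not exist, so `n(t,r)` is the supremum of a superlevel set. Power decay
  -- makes the set nonempty and bounded; monotonicity of `φ` makes it shrink as `t` grows, hence `n`
  -- non-increasing.
  let A : ℝ → ℝ → Set ℝ := fun t r => {n | 0 < n ∧ 1 ≤ Φ (r / n) * φ (n / t)}
  have gpos : ∀ t r k, 0 < t → 0 < r → 0 < k → 0 < Φ (r / k) * φ (k / t) := fun t r k ht hr hk =>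
    mul_pos (hΦ.pos (div_pos hr hk)) (hsφ.pos _ (div_pos hk ht))
  have hne : ∀ t r, 0 < t → 0 < r → (A t r).Nonempty := by
    intro t r ht hr
    have p := gpos t r 1 ht hr one_pos
    obtain ⟨u, hu1, hu⟩ := ((Filter.eventually_ge_atTop (1 : ℝ)).and
      ((tendsto_rpow_atTop hδ).eventually_ge_atTop (C / (Φ (r / 1) * φ (1 / t))))).exists
    have hu0 : 0 < u := by linarith
    have h := hg t r (1 / u) 1 ht hr (by positivity) ((div_le_one hu0).2 hu1)
    rw [one_div_one_div] at h
    rw [div_le_iff₀ p] at hu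
    refine ⟨1 / u, by positivity, ?_⟩
    have := hu.trans h
    exact le_of_mul_le_mul_left (by simpa using this) hC
  have hbdd : ∀ t r, 0 < t → 0 < r → BddAbove (A t r) := by
    intro t r ht hr
    refine ⟨max 1 ((C * (Φ (r / 1) * φ (1 / t))) ^ (α₁ - β₂)⁻¹), fun n hn => ?_⟩
    rcases le_total n 1 with h1 | h1
    · exact h1.trans (le_max_left _ _)
    · have h := hg t r 1 n ht hr one_pos h1
      rw [div_one n] at h
      have hp : 0 < n ^ (α₁ - β₂) := Real.rpow_pos_of_pos hn.1 _
      refine (le_rpow_inv_of_rpow_le hn.1.le hδ ?_).trans (le_max_right _ _)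
      nlinarith [hn.2]
  have hpos : ∀ t r, 0 < t → 0 < r → 0 < sSup (A t r) := fun t r ht hr => by
    obtain ⟨n, hn⟩ := hne t r ht hr
    exact hn.1.trans_le (le_csSup (hbdd t r ht hr) hn)
  refine ⟨fun t r => sSup (A t r), hpos, fun r hr t ht u hu htu => ?_,
    1 / (c₂ * 2 ^ α₂), c₂ * 2 ^ α₂, by positivity, by positivity, fun t r ht hr => ?_⟩
  · refine csSup_le_csSup (hbdd t r ht hr) (hne u r hu hr) fun n hn => ⟨hn.1, hn.2.trans ?_⟩
    have ht' : 0 < t := ht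
    have hu' : 0 < u := hu
    have hn0 := hn.1
    have := (hΦ.pos (div_pos hr hn.1)).le
    gcongr
    exact hsφ.mono (div_pos hn0 hu') (div_pos hn0 ht') (by gcongr)
  · have hs0 := hpos t r ht hr
    set s := sSup (A t r) with hsdef
    have p1 := hsφ.pos _ (div_pos hs0 ht)
    constructor
    -- The supremum may or may not belong to the set, so it is compared with `2s`, outside the set,
    -- and below with some `k` of the set in `(s/2, s]`. Either move costs `c₂ 2^{α₂}`.
    · have hnot : 2 * s ∉ A t r := fun h => by
        have := le_csSup (hbdd t r ht hr) h
        linarith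
      have h2 : Φ (r / (2 * s)) * φ (2 * s / t) < 1 := by
        by_contra! hcon
        exact hnot ⟨by positivity, hcon⟩
      have h3 := hs.le_mul (r := r / (2 * s)) (R := r / s) (by positivity)
        (by gcongr; linarith)
      have e : r / s / (r / (2 * s)) = 2 := by field_simp
      rw [e] at h3
      have h4 : φ (s / t) ≤ φ (2 * s / t) :=
        hsφ.mono (div_pos hs0 ht) (mem_Ioi.2 (by positivity)) (by gcongr; linarith)
      have p2 := hΦ.pos (show 0 < r / (2 * s) by positivity)
      rw [one_div_mul_eq_div, div_le_div_iff₀ (by positivity) p1, one_mul]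
      calc Φ (r / s) * φ (s / t) ≤ (c₂ * 2 ^ α₂ * Φ (r / (2 * s))) * φ (2 * s / t) := by gcongr
        _ = c₂ * 2 ^ α₂ * (Φ (r / (2 * s)) * φ (2 * s / t)) := by ring
        _ ≤ c₂ * 2 ^ α₂ * 1 := by gcongr
        _ = _ := by ring
    · obtain ⟨k, hk, hks⟩ := exists_lt_of_lt_csSup (hne t r ht hr) (show s / 2 < s by linarith)
      have hk0 := hk.1
      have hks' : k ≤ s := le_csSup (hbdd t r ht hr) hk
      have h3 := hs.le_mul (r := r / s) (R := r / k) (by positivity) (by gcongr)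
      have e : r / k / (r / s) ≤ 2 := by
        rw [div_div_div_cancel_left' _ _ hr.ne', div_le_iff₀ hk0]; linarith
      have h4 : φ (k / t) ≤ φ (s / t) :=
        hsφ.mono (div_pos hk0 ht) (div_pos hs0 ht) (by gcongr)
      have p2 := hΦ.pos (div_pos hr hs0)
      have hα₂ : 0 ≤ α₂ := by linarith [hΦ.scaling.1, hΦ.scaling.2.1]
      rw [div_le_iff₀ p1]
      calc 1 ≤ Φ (r / k) * φ (k / t) := hk.2
        _ ≤ (c₂ * (r / k / (r / s)) ^ α₂ * Φ (r / s)) * φ (s / t) := by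
          have := hsφ.pos _ (div_pos hk0 ht)
          gcongr
        _ ≤ (c₂ * 2 ^ α₂ * Φ (r / s)) * φ (s / t) := by gcongr

/-- `n(t,r)` is bounded below on `Φ(r) φ(1/t) ≥ 1`. -/
theorem IsFractionalExponent.bounded_below {n : ℝ → ℝ → ℝ} (hn : IsFractionalExponent φ Φ n)
    (hΦ : IsScale α₁ α₂ Φ) (hφ : WeakScaling β₁ β₂ φ) (hαβ : β₂ < α₁) :
    ∃ c, 0 < c ∧ ∀ t r, 0 < t → 0 < r → 1 ≤ Φ r * φ t⁻¹ → c ≤ n t r := by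
  obtain ⟨C, hC, hg⟩ := hΦ.div_mul_scaling hφ
  obtain ⟨k₁, k₂, hk₁, hk₂, hk⟩ := hn.scale
  have hδ : 0 < α₁ - β₂ := by linarith
  refine ⟨min 1 ((C / k₁) ^ (α₁ - β₂)⁻¹)⁻¹, by positivity, fun t r ht hr h => ?_⟩
  rcases le_total 1 (n t r) with h1 | h1
  · exact (min_le_left _ _).trans h1
  have hn0 := hn.pos t r ht hr
  obtain ⟨-, -, b₁, b₂, -, hb₂, hsφ⟩ := hφ
  have p1 := hsφ.pos _ (div_pos hn0 ht)
  -- Comparing `n ≤ 1` with 1, where the product is at least 1, bounds `(1/n)^{α₁-β₂}` by `C` times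
  -- the product at `n`, which is at most `1/k₁`.
  have h2 := hg t r _ 1 ht hr hn0 h1
  have h3 := (hk t r ht hr).1
  rw [le_div_iff₀ p1] at h3
  rw [div_one r, one_div t] at h2
  refine (min_le_right _ _).trans ?_
  rw [inv_le_comm₀ (by positivity) hn0]
  refine le_rpow_inv_of_rpow_le (by positivity) hδ ?_
  rw [← one_div, le_div_iff₀ hk₁]
  have hp : 0 < (1 / n t r) ^ (α₁ - β₂) := by positivity
  calc (1 / n t r) ^ (α₁ - β₂) * k₁ ≤ (1 / n t r) ^ (α₁ - β₂) * (Φ r * φ t⁻¹) * k₁ := by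
        gcongr; nlinarith
    _ ≤ C * (Φ (r / n t r) * φ (n t r / t)) * k₁ := by gcongr
    _ = C * (k₁ * Φ (r / n t r) * φ (n t r / t)) := by ring
    _ ≤ C * 1 := by gcongr
    _ = C := mul_one _

end FractionalExponent

/-! ### Tail estimates for the subordinator -/

section Tails

variable {Ω : Type*} [MeasurableSpace Ω] {S : ℝ≥0 → Ω → ℝ} {Q : Measure Ω}
  {φ : ℝ → ℝ} {β₁ β₂ : ℝ}

theorem passageProb_eq_integral (hS : IsSubordinator S Q) (t r : ℝ) :
    passageProb S Q t r = ∫ ω, {ω | t ≤ S r.toNNReal ω}.indicator (fun _ => (1 : ℝ)) ω ∂Q := by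
  rw [integral_indicator_const _ (measurableSet_le measurable_const (hS.measurable _))]
  simp [passageProb]

theorem IsSubordinator.ae_nonneg (hS : IsSubordinator S Q) (r : ℝ≥0) : ∀ᵐ ω ∂Q, 0 ≤ S r ω := by
  filter_upwards [hS.zero, hS.mono] with ω h0 h
  rw [← h0]
  exact h zero_le

variable [IsProbabilityMeasure Q]

theorem IsSubordinator.integrable_exp (hS : IsSubordinator S Q) (r : ℝ≥0) {l : ℝ} (hl : 0 < l) :
    Integrable (fun ω => Real.exp (-(l * S r ω))) Q := by
  refine Integrable.of_bound ((hS.measurable r).const_mul l).neg.exp.aestronglyMeasurable 1 ?_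
  filter_upwards [hS.ae_nonneg r] with ω h
  rw [Real.norm_of_nonneg (Real.exp_pos _).le]
  exact Real.exp_le_one_iff.2 (by nlinarith)

theorem passageProb_le_one (t r : ℝ) : passageProb S Q t r ≤ 1 := measureReal_le_one

theorem one_sub_passageProb (hS : IsSubordinator S Q) (t r : ℝ) :
    1 - passageProb S Q t r = Q.real {ω | S r.toNNReal ω < t} := by
  have : {ω | S r.toNNReal ω < t} = {ω | t ≤ S r.toNNReal ω}ᶜ := by ext; simp
  rw [this, probReal_compl_eq_one_sub (measurableSet_le measurable_const (hS.measurable _))]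
  rfl

theorem integrable_passage_indicator (hS : IsSubordinator S Q) (t r : ℝ) :
    Integrable ({ω | t ≤ S r.toNNReal ω}.indicator (fun _ => (1 : ℝ))) Q :=
  (integrable_const 1).indicator (measurableSet_le measurable_const (hS.measurable _))

theorem integral_one_sub_exp (hS : IsSubordinator S Q) (hφ : HasLaplaceExponent S Q φ) {r l : ℝ}
    (hr : 0 ≤ r) (hl : 0 < l) :
    ∫ ω, (1 - Real.exp (-(l * S r.toNNReal ω))) ∂Q = 1 - Real.exp (-(r * φ l)) := by
  rw [integral_sub (integrable_const 1) (hS.integrable_exp _ hl), hφ _ l hl]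
  simp [hr]

theorem one_sub_exp_neg_one_pos : 0 < 1 - Real.exp (-1) := by
  simp

/-- Markov's inequality for `1 - e^{-S_r/t}`, which is at least `1 - 1/e` on `{S_r ≥ t}` and has
mean `1 - e^{-rφ(1/t)}`. -/
theorem passageProb_le (hS : IsSubordinator S Q) (hφ : HasLaplaceExponent S Q φ) {t r : ℝ}
    (ht : 0 < t) (hr : 0 ≤ r) :
    passageProb S Q t r ≤ (1 - Real.exp (-1))⁻¹ * (r * φ t⁻¹) := by
  have h0 := one_sub_exp_neg_one_pos
  have hl : 0 < t⁻¹ := by positivity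
  rw [le_inv_mul_iff₀ h0]
  calc (1 - Real.exp (-1)) * passageProb S Q t r
      = ∫ ω, (1 - Real.exp (-1)) * {ω | t ≤ S r.toNNReal ω}.indicator (fun _ => (1 : ℝ)) ω ∂Q := by
        rw [integral_const_mul, passageProb_eq_integral hS]
    _ ≤ ∫ ω, (1 - Real.exp (-(t⁻¹ * S r.toNNReal ω))) ∂Q := by
        refine integral_mono_ae ((integrable_passage_indicator hS t r).const_mul _)
          ((integrable_const 1).sub (hS.integrable_exp _ hl)) ?_
        filter_upwards [hS.ae_nonneg r.toNNReal] with ω h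
        by_cases hω : t ≤ S r.toNNReal ω
        · have : 1 ≤ t⁻¹ * S r.toNNReal ω := by rwa [inv_mul_eq_div, one_le_div ht]
          rw [indicator_of_mem (by exact hω), mul_one]
          gcongr
        · have : 0 ≤ t⁻¹ * S r.toNNReal ω := by positivity
          simpa [indicator, hω] using this
    _ = 1 - Real.exp (-(r * φ t⁻¹)) := integral_one_sub_exp hS hφ hr hl
    _ ≤ r * φ t⁻¹ := by linarith [Real.add_one_le_exp (-(r * φ t⁻¹))]

/-- Chernoff's bound; the frequency `l` stays free because later uses take it to be `1/t`, `n/t` or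
a small multiple of `n/t`. -/
theorem one_sub_passageProb_le (hS : IsSubordinator S Q) (hφ : HasLaplaceExponent S Q φ)
    (t : ℝ) {r l : ℝ} (hr : 0 ≤ r) (hl : 0 < l) :
    1 - passageProb S Q t r ≤ Real.exp (l * t - r * φ l) := by
  have e : Real.exp (l * t - r * φ l)
      = ∫ ω, Real.exp (l * t) * Real.exp (-(l * S r.toNNReal ω)) ∂Q := by
    rw [integral_const_mul, hφ _ l hl, ← Real.exp_add]
    simp [hr, sub_eq_add_neg]
  have hm : MeasurableSet {ω | S r.toNNReal ω < t} :=
    measurableSet_lt (hS.measurable _) measurable_const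
  rw [e, one_sub_passageProb hS, show Q.real {ω | S r.toNNReal ω < t}
    = ∫ ω, {ω | S r.toNNReal ω < t}.indicator (fun _ => (1 : ℝ)) ω ∂Q by
      rw [integral_indicator_const _ hm]; simp]
  refine integral_mono_ae ((integrable_const 1).indicator hm)
    ((hS.integrable_exp _ hl).const_mul _) (Filter.Eventually.of_forall fun ω => ?_)
  dsimp only
  rw [← Real.exp_add]
  by_cases hω : S r.toNNReal ω < t
  · rw [indicator_of_mem (by exact hω)]
    exact Real.one_le_exp (by nlinarith)
  · rw [indicator_of_notMem (by exact hω)]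
    positivity

/-- Test with `1 - e^{-S_r/(ut)}`. Its mean is at least of order `u^{-β₂} rφ(1/t)` by scaling, while
the part from `{S_r < t}` is at most of order `u^{-1} rφ(1/t)`. Since `β₂ < 1`, a large `u` leaves a
positive share for `{S_r ≥ t}`. -/
theorem le_passageProb (hS : IsSubordinator S Q) (hφ : HasLaplaceExponent S Q φ)
    (hβ : β₂ < 1) (hφs : WeakScaling β₁ β₂ φ) :
    ∃ c, 0 < c ∧ ∀ t r, 0 < t → 0 ≤ r → r * φ t⁻¹ ≤ 1 → c * (r * φ t⁻¹) ≤ passageProb S Q t r := by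
  obtain ⟨-, -, b₁, b₂, hb₁, hb₂, hs⟩ := hφs
  set e₁ := 1 - Real.exp (-1) with he₁
  have h0 : 0 < e₁ := one_sub_exp_neg_one_pos
  have hlin : ∀ u, 0 ≤ u → u ≤ 1 → e₁ * u ≤ 1 - Real.exp (-u) := by
    intro u hu hu1
    have := convexOn_exp.2 (mem_univ (0 : ℝ)) (mem_univ (-1 : ℝ)) (sub_nonneg.2 hu1) hu (by ring)
    simp only [smul_eq_mul, mul_zero, zero_add, mul_neg, mul_one, Real.exp_zero] at this
    rw [he₁]
    linarith
  -- a small multiple `k` of the frequency makes the contribution of `{S < t}` negligible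
  obtain ⟨u, hu1, hu⟩ := ((Filter.eventually_ge_atTop (1 : ℝ)).and
    ((tendsto_rpow_atTop (sub_pos.2 hβ)).eventually_ge_atTop (2 * b₂ / e₁ ^ 2))).exists
  have hu0 : 0 < u := by linarith
  refine ⟨e₁⁻¹ * u⁻¹, by positivity, fun t r ht hr hrt => ?_⟩
  have hl : 0 < t⁻¹ := by positivity
  have hl' : 0 < u⁻¹ * t⁻¹ := by positivity
  have hlt : u⁻¹ * t⁻¹ ≤ t⁻¹ := by
    have : u⁻¹ ≤ 1 := inv_le_one_of_one_le₀ hu1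
    nlinarith
  have hp := hs.pos _ hl
  have hp' := hs.pos _ hl'
  have hmono := hs.mono hl' hl hlt
  have h1 : e₁ * (r * φ (u⁻¹ * t⁻¹)) ≤ passageProb S Q t r + u⁻¹ * e₁⁻¹ * (r * φ t⁻¹) := by
    calc e₁ * (r * φ (u⁻¹ * t⁻¹)) ≤ 1 - Real.exp (-(r * φ (u⁻¹ * t⁻¹))) :=
          hlin _ (by positivity) (le_trans (by gcongr) hrt)
      _ = ∫ ω, (1 - Real.exp (-(u⁻¹ * t⁻¹ * S r.toNNReal ω))) ∂Q :=
          (integral_one_sub_exp hS hφ hr hl').symm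
      _ ≤ ∫ ω, ({ω | t ≤ S r.toNNReal ω}.indicator (fun _ => (1 : ℝ)) ω
            + u⁻¹ * e₁⁻¹ * (1 - Real.exp (-(t⁻¹ * S r.toNNReal ω)))) ∂Q := by
          refine integral_mono_ae ((integrable_const 1).sub (hS.integrable_exp _ hl'))
            ((integrable_passage_indicator hS t r).add
              (((integrable_const 1).sub (hS.integrable_exp _ hl)).const_mul _)) ?_
          filter_upwards [hS.ae_nonneg r.toNNReal] with ω h
          have hq : 0 ≤ t⁻¹ * S r.toNNReal ω := by positivity
          by_cases hω : t ≤ S r.toNNReal ω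
          · rw [indicator_of_mem (by exact hω)]
            have : 0 ≤ 1 - Real.exp (-(t⁻¹ * S r.toNNReal ω)) := by simpa using hq
            have : 0 ≤ u⁻¹ * e₁⁻¹ * (1 - Real.exp (-(t⁻¹ * S r.toNNReal ω))) := by positivity
            linarith [Real.exp_pos (-(u⁻¹ * t⁻¹ * S r.toNNReal ω))]
          · rw [indicator_of_notMem (by exact hω), zero_add]
            have hq1 : t⁻¹ * S r.toNNReal ω ≤ 1 := by
              rw [inv_mul_eq_div, div_le_one ht]; exact (not_le.1 hω).le
            have := hlin _ hq hq1
            calc 1 - Real.exp (-(u⁻¹ * t⁻¹ * S r.toNNReal ω)) ≤ u⁻¹ * t⁻¹ * S r.toNNReal ω := by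
                  linarith [Real.add_one_le_exp (-(u⁻¹ * t⁻¹ * S r.toNNReal ω))]
              _ = u⁻¹ * e₁⁻¹ * (e₁ * (t⁻¹ * S r.toNNReal ω)) := by field_simp
              _ ≤ _ := by gcongr
      _ = passageProb S Q t r + u⁻¹ * e₁⁻¹ * (1 - Real.exp (-(r * φ t⁻¹))) := by
          have hi : Integrable
              (fun ω => u⁻¹ * e₁⁻¹ * (1 - Real.exp (-(t⁻¹ * S r.toNNReal ω)))) Q :=
            ((integrable_const 1).sub (hS.integrable_exp _ hl)).const_mul _
          rw [integral_add (integrable_passage_indicator hS t r) hi,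
            integral_const_mul, integral_one_sub_exp hS hφ hr hl, passageProb_eq_integral hS]
      _ ≤ _ := by
          gcongr
          linarith [Real.add_one_le_exp (-(r * φ t⁻¹))]
  have h2 := hs.le_mul hl' hlt
  have e : t⁻¹ / (u⁻¹ * t⁻¹) = u := by field_simp
  rw [e] at h2
  have h3 : 2 * e₁⁻¹ * u⁻¹ * φ t⁻¹ ≤ e₁ * φ (u⁻¹ * t⁻¹) := by
    rw [Real.rpow_sub hu0, Real.rpow_one, div_le_div_iff₀ (by positivity) (by positivity)] at hu
    have h4 : 2 * φ t⁻¹ ≤ u * e₁ ^ 2 * φ (u⁻¹ * t⁻¹) := by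
      calc 2 * φ t⁻¹ ≤ 2 * (b₂ * u ^ β₂ * φ (u⁻¹ * t⁻¹)) := by gcongr
        _ = (2 * b₂ * u ^ β₂) * φ (u⁻¹ * t⁻¹) := by ring
        _ ≤ _ := by gcongr
    calc 2 * e₁⁻¹ * u⁻¹ * φ t⁻¹ = e₁⁻¹ * u⁻¹ * (2 * φ t⁻¹) := by ring
      _ ≤ e₁⁻¹ * u⁻¹ * (u * e₁ ^ 2 * φ (u⁻¹ * t⁻¹)) := by gcongr
      _ = _ := by field_simp
  have h5 := mul_le_mul_of_nonneg_left h3 hr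
  linarith

/-- If each of `k+1` successive increments over time `r` stays below `s`, the sum stays below
`(k+1)s`; these increments are independent and identically distributed. -/
theorem pow_one_sub_passageProb_le (hS : IsSubordinator S Q) (s : ℝ) {r : ℝ} (hr : 0 ≤ r) (k : ℕ) :
    (1 - passageProb S Q s r) ^ (k + 1) ≤ 1 - passageProb S Q ((k + 1) * s) ((k + 1) * r) := by
  induction k with
  | zero => simp
  | succ k ih =>
    have h0 : 0 ≤ 1 - passageProb S Q s r := sub_nonneg.2 (passageProb_le_one _ _)
    set a : ℝ≥0 := (((k : ℝ) + 1) * r).toNNReal with ha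
    have hab : (((k + 1 : ℕ) : ℝ) + 1) * r = ((k : ℝ) + 1) * r + r := by push_cast; ring
    have hb : ((((k + 1 : ℕ) : ℝ) + 1) * r).toNNReal = a + r.toNNReal := by
      rw [hab, Real.toNNReal_add (by positivity) hr]
    have hind := hS.indep.indepFun_eval_sub (zero_le : 0 ≤ a)
      (le_self_add : a ≤ a + r.toNNReal) hS.zero
    have hmeas : Q ((S a) ⁻¹' Iio ((k + 1) * s) ∩ (S (a + r.toNNReal) - S a) ⁻¹' Iio s)
        = Q ((S a) ⁻¹' Iio ((k + 1) * s)) * Q ((S (a + r.toNNReal) - S a) ⁻¹' Iio s) :=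
      hind.measure_inter_preimage_eq_mul _ _ measurableSet_Iio measurableSet_Iio
    have hst : Q ((S (a + r.toNNReal) - S a) ⁻¹' Iio s) = Q (S r.toNNReal ⁻¹' Iio s) :=
      (hS.stationary a r.toNNReal).measure_mem_eq measurableSet_Iio
    rw [pow_succ]
    calc (1 - passageProb S Q s r) ^ (k + 1) * (1 - passageProb S Q s r)
        ≤ (1 - passageProb S Q ((k + 1) * s) ((k + 1) * r)) * (1 - passageProb S Q s r) := by
          gcongr
      _ = Q.real ((S a) ⁻¹' Iio ((k + 1) * s) ∩ (S (a + r.toNNReal) - S a) ⁻¹' Iio s) := by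
          rw [one_sub_passageProb hS, one_sub_passageProb hS, measureReal_def, measureReal_def,
            measureReal_def, hmeas, ENNReal.toReal_mul, hst]
          rfl
      _ ≤ 1 - passageProb S Q (((k + 1 : ℕ) + 1) * s) (((k + 1 : ℕ) + 1) * r) := by
          rw [one_sub_passageProb hS, hb]
          refine measureReal_mono fun ω hω => ?_
          have h1 : S a ω < (k + 1) * s := hω.1
          have h2 : S (a + r.toNNReal) ω - S a ω < s := hω.2
          show S (a + r.toNNReal) ω < (((k + 1 : ℕ) : ℝ) + 1) * s
          push_cast
          linarith

/-- Up to times of order `n / φ(n/t)` the subordinator stays below `t` with probability at least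
exponentially small in `n`. -/
theorem exp_neg_le_one_sub_passageProb (hS : IsSubordinator S Q) (hφ : HasLaplaceExponent S Q φ)
    (hβ : β₂ < 1) (hφs : WeakScaling β₁ β₂ φ) {A n₀ : ℝ} (hA : 0 < A) (hn₀ : 0 < n₀) :
    ∃ C, 0 < C ∧ ∀ t n r, 0 < t → n₀ ≤ n → 0 ≤ r → r ≤ A * (n / φ (n / t)) →
      Real.exp (-(C * n)) ≤ 1 - passageProb S Q t r := by
  obtain ⟨-, -, b₁, b₂, hb₁, hb₂, hs⟩ := hφs
  set e₁ := 1 - Real.exp (-1) with he₁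
  have h0 : 0 < e₁ := one_sub_exp_neg_one_pos
  obtain ⟨B, hB1, hB⟩ := ((Filter.eventually_ge_atTop (1 : ℝ)).and
    ((tendsto_rpow_atTop (sub_pos.2 hβ)).eventually_ge_atTop (2 * (e₁⁻¹ * A * b₂)))).exists
  have hB0 : 0 < B := by linarith
  refine ⟨B + 1 / n₀, by positivity, fun t n r ht hn hr hrn => ?_⟩
  have hn0 : 0 < n := hn₀.trans_le hn
  -- Time and level are cut into `N = ⌊Bn⌋ + 1` equal blocks. The choice of `B` makes the Markov
  -- bound in one block at most 1/2, so the blocks jointly give at least `2^{-N} ≥ e^{-N}`; since `n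
  -- ≥ n₀`, `N ≤ (B + 1/n₀)n`.
  obtain ⟨k, hk1, hk2⟩ : ∃ k : ℕ, B * n ≤ (k : ℝ) + 1 ∧ (k : ℝ) ≤ B * n := by
    refine ⟨⌊B * n⌋₊, (Nat.lt_floor_add_one _).le, Nat.floor_le (by positivity)⟩
  set N : ℝ := k + 1 with hN
  have hN0 : 0 < N := by positivity
  have hp := hs.pos _ (div_pos hn0 ht)
  have hnN : n ≤ N := le_trans (by nlinarith) hk1
  have hpow := pow_one_sub_passageProb_le hS (t / N) (r := r / N) (by positivity) k
  rw [← hN, mul_div_cancel₀ _ hN0.ne', mul_div_cancel₀ _ hN0.ne'] at hpow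
  have hhalf : passageProb S Q (t / N) (r / N) ≤ 1 / 2 := by
    refine (passageProb_le hS hφ (div_pos ht hN0) (by positivity)).trans ?_
    rw [← he₁, inv_div]
    have h1 := hs.le_mul (r := n / t) (R := N / t) (by positivity) (by gcongr)
    have e : N / t / (n / t) = N / n := by field_simp
    rw [e] at h1
    have hx : 0 < N / n := by positivity
    have h2 : 2 * (e₁⁻¹ * A * b₂) ≤ (N / n) ^ (1 - β₂) := by
      refine hB.trans (Real.rpow_le_rpow hB0.le ?_ (by linarith))
      rwa [le_div_iff₀ hn0]
    rw [Real.rpow_sub hx, Real.rpow_one, le_div_iff₀ (by positivity)] at h2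
    calc e₁⁻¹ * (r / N * φ (N / t))
        ≤ e₁⁻¹ * (A * (n / φ (n / t)) / N * (b₂ * (N / n) ^ β₂ * φ (n / t))) := by
          have := hs.pos _ (div_pos hN0 ht)
          gcongr
      _ = (2 * (e₁⁻¹ * A * b₂) * (N / n) ^ β₂) * (n / N) / 2 := by field_simp
      _ ≤ N / n * (n / N) / 2 := by gcongr
      _ = 1 / 2 := by field_simp
  refine le_trans ?_ hpow
  calc Real.exp (-((B + 1 / n₀) * n)) ≤ Real.exp (((k + 1 : ℕ) : ℝ) * (-1)) := by
        refine Real.exp_le_exp.2 ?_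
        have : 1 ≤ 1 / n₀ * n := by rw [one_div_mul_eq_div, one_le_div hn₀]; exact hn
        push_cast
        linarith
    _ = Real.exp (-1) ^ (k + 1) := Real.exp_nat_mul _ _
    _ ≤ (1 - passageProb S Q (t / N) (r / N)) ^ (k + 1) := by
        gcongr
        have : Real.exp (-1) ≤ 1 / 2 := by
          rw [Real.exp_neg, ← one_div]
          exact one_div_le_one_div_of_le (by norm_num) (by linarith [Real.add_one_le_exp (1 : ℝ)])
        linarith

end Tails

/-! ### The passage measure -/

section PassageMeasure

variable {Ω : Type*} [MeasurableSpace Ω] {S : ℝ≥0 → Ω → ℝ} {Q : Measure Ω}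
  [IsProbabilityMeasure Q] {φ : ℝ → ℝ} {β₁ β₂ : ℝ}

instance sfinite_passageMeasure (hS : IsSubordinator S Q) (t : ℝ) :
    SFinite (passageMeasure hS t) := by
  unfold passageMeasure; infer_instance

/-- The Stieltjes measure uses the right limits of `r ↦ P(S_r ≥ t)`. These are bracketed by the
values at `r` and at any later time, so right continuity is not needed; the price is the doubled
arguments `2a`, `2b` below. -/
theorem passageProb_le_stieltjes (hS : IsSubordinator S Q) (t r : ℝ) :
    passageProb S Q t r ≤ (passageProb_mono hS t).stieltjesFunction r := by
  rw [Monotone.stieltjesFunction_eq]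
  exact (passageProb_mono hS t).le_rightLim le_rfl

theorem stieltjes_le_passageProb (hS : IsSubordinator S Q) (t : ℝ) {r s : ℝ} (hrs : r < s) :
    (passageProb_mono hS t).stieltjesFunction r ≤ passageProb S Q t s := by
  rw [Monotone.stieltjesFunction_eq]
  exact (passageProb_mono hS t).rightLim_le hrs

theorem passageMeasure_Ioc_zero_le (hS : IsSubordinator S Q) (hφ : HasLaplaceExponent S Q φ)
    {t b : ℝ} (ht : 0 < t) (hb : 0 < b) :
    passageMeasure hS t (Ioc 0 b)
      ≤ ENNReal.ofReal (2 * (1 - Real.exp (-1))⁻¹ * φ t⁻¹ * b) := by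
  refine (Measure.restrict_apply_le _ _).trans ?_
  rw [StieltjesFunction.measure_Ioc]
  refine ENNReal.ofReal_le_ofReal ?_
  have h1 := stieltjes_le_passageProb hS t (show b < 2 * b by linarith)
  have h2 := passageProb_le_stieltjes hS t 0
  have h3 : 0 ≤ passageProb S Q t 0 := measureReal_nonneg
  have h4 := passageProb_le hS hφ ht (show 0 ≤ 2 * b by linarith)
  linarith

theorem le_passageMeasure_Ioc (hS : IsSubordinator S Q) (t : ℝ) {a b : ℝ} (ha : 0 < a) :
    ENNReal.ofReal (passageProb S Q t b - passageProb S Q t (2 * a))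
      ≤ passageMeasure hS t (Ioc a b) := by
  have hsub : Ioc a b ⊆ Ioi 0 := fun x hx => ha.trans hx.1
  rw [passageMeasure, Measure.restrict_eq_self _ hsub, StieltjesFunction.measure_Ioc]
  refine ENNReal.ofReal_le_ofReal ?_
  have h1 := stieltjes_le_passageProb hS t (show a < 2 * a by linarith)
  have h2 := passageProb_le_stieltjes hS t b
  linarith

theorem passageMeasure_Ioi_le (hS : IsSubordinator S Q) (t a : ℝ) :
    passageMeasure hS t (Ioi a) ≤ ENNReal.ofReal (1 - passageProb S Q t a) := by
  refine (Measure.restrict_apply_le _ _).trans ?_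
  set G := (passageProb_mono hS t).stieltjesFunction with hG
  have hle : ∀ x, G x ≤ 1 := fun x =>
    (stieltjes_le_passageProb hS t (show x < x + 1 by linarith)).trans (passageProb_le_one _ _)
  have hbdd : BddAbove (range G) := ⟨1, by rintro _ ⟨x, rfl⟩; exact hle x⟩
  rw [StieltjesFunction.measure_Ioi _ (tendsto_atTop_ciSup G.mono hbdd)]
  exact ENNReal.ofReal_le_ofReal (sub_le_sub (ciSup_le hle) (passageProb_le_stieltjes hS t a))

theorem passageMeasure_le_one (hS : IsSubordinator S Q) (t : ℝ) (s : Set ℝ) :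
    passageMeasure hS t s ≤ 1 := by
  have h : passageMeasure hS t univ ≤ passageMeasure hS t (Ioi 0) := by
    simp [passageMeasure]
  calc passageMeasure hS t s ≤ passageMeasure hS t univ := measure_mono (subset_univ s)
    _ ≤ ENNReal.ofReal (1 - passageProb S Q t 0) := h.trans (passageMeasure_Ioi_le hS t 0)
    _ ≤ ENNReal.ofReal 1 := ENNReal.ofReal_le_ofReal (sub_le_self _ measureReal_nonneg)
    _ = 1 := ENNReal.ofReal_one

/-- The passage measure charges `(r, K r]` at least proportionally to `r φ(1/t)`. -/
theorem exists_le_passageMeasure_Ioc (hS : IsSubordinator S Q) (hφ : HasLaplaceExponent S Q φ)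
    (hβ : β₂ < 1) (hφs : WeakScaling β₁ β₂ φ) :
    ∃ K c : ℝ, 1 ≤ K ∧ 0 < c ∧ ∀ t r, 0 < t → 0 < r → r * φ t⁻¹ ≤ 2 →
      ENNReal.ofReal (c * φ t⁻¹ * r) ≤ passageMeasure hS t (Ioc r (K * r)) := by
  obtain ⟨c₀, hc₀, hlow⟩ := le_passageProb hS hφ hβ hφs
  obtain ⟨C', hC', hneg⟩ := exp_neg_le_one_sub_passageProb hS hφ hβ hφs
    (A := 4) (by norm_num) one_pos
  obtain ⟨-, -, b₁, b₂, -, -, hs⟩ := hφs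
  set e₁ := (1 - Real.exp (-1))⁻¹ with he₁
  have h0 : 0 < e₁ := inv_pos.2 one_sub_exp_neg_one_pos
  -- With this `K₁`, as long as `K₁rφ(1/t) ≤ 1`, the linear lower bound at time `K₁r` exceeds the
  -- linear upper bound at time `2r` by at least `rφ(1/t)`.
  set K₁ := max 1 ((2 * e₁ + 1) / c₀) with hK₁
  have hK₁1 : 1 ≤ K₁ := le_max_left _ _
  have hK₁c : 2 * e₁ + 1 ≤ c₀ * K₁ := by
    rw [← div_le_iff₀' hc₀]; exact le_max_right _ _
  refine ⟨K₁ * (2 + C'), min 1 (Real.exp (-C') / 4), by nlinarith, by positivity,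
    fun t r ht hr hrt => ?_⟩
  have hp := hs.pos t⁻¹ (by positivity)
  rcases le_total (K₁ * r * φ t⁻¹) 1 with h1 | h1
  · calc ENNReal.ofReal (min 1 (Real.exp (-C') / 4) * φ t⁻¹ * r)
        ≤ ENNReal.ofReal (passageProb S Q t (K₁ * r) - passageProb S Q t (2 * r)) := by
          refine ENNReal.ofReal_le_ofReal ?_
          have h2 := hlow t (K₁ * r) ht (by positivity) h1
          have h3 := passageProb_le hS hφ ht (show 0 ≤ 2 * r by positivity)
          have h4 : (2 * e₁ + 1) * (r * φ t⁻¹) ≤ c₀ * K₁ * (r * φ t⁻¹) := by gcongr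
          have h5 : min 1 (Real.exp (-C') / 4) * (φ t⁻¹ * r) ≤ 1 * (φ t⁻¹ * r) := by
            gcongr; exact min_le_left _ _
          linarith
      _ ≤ passageMeasure hS t (Ioc r (K₁ * r)) := le_passageMeasure_Ioc hS t hr
      _ ≤ _ := by
          refine measure_mono (Ioc_subset_Ioc_right ?_)
          have : K₁ * 1 ≤ K₁ * (2 + C') := by gcongr; linarith
          nlinarith
  -- Here `rφ(1/t)` lies in `[1/K₁, 2]`: `S_{2r} < t` has probability at least `e^{-C'}`, and at
  -- time `K₁(2+C')r` Chernoff leaves at most `e^{-C'-1}`.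
  · refine le_trans (ENNReal.ofReal_le_ofReal ?_) (le_passageMeasure_Ioc hS t hr)
    have h2 := hneg t 1 (2 * r) ht le_rfl (by positivity) (by
      rw [one_div t, mul_one_div, le_div_iff₀ hp]; linarith)
    have h3 := one_sub_passageProb_le hS hφ t (r := K₁ * (2 + C') * r) (by positivity)
      (inv_pos.2 ht)
    have h4 : Real.exp (t⁻¹ * t - K₁ * (2 + C') * r * φ t⁻¹) ≤ Real.exp (-C' + -1) := by
      refine Real.exp_le_exp.2 ?_
      rw [inv_mul_cancel₀ ht.ne']
      nlinarith
    have h5 : Real.exp (-C' + -1) ≤ Real.exp (-C') / 2 := by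
      rw [Real.exp_add, Real.exp_neg 1, div_eq_mul_inv]
      gcongr
      linarith [Real.add_one_le_exp (1 : ℝ)]
    rw [mul_one] at h2
    have h6 : min 1 (Real.exp (-C') / 4) * (r * φ t⁻¹) ≤ Real.exp (-C') / 4 * 2 := by
      gcongr; exact min_le_right _ _
    linarith

/-- With `s = n/φ(n/t)`, the probability of staying below `t` is at least `e^{-C'n}` at time `2s`,
and by Chernoff at frequency `n/t` at most `e^{-(C'+1/n₀)n}` at time `Ks`. As `n/n₀ ≥ 1`, the latter
is at most half the former. -/
theorem exists_exp_neg_le_passageMeasure_Ioc (hS : IsSubordinator S Q)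
    (hφ : HasLaplaceExponent S Q φ) (hβ : β₂ < 1) (hφs : WeakScaling β₁ β₂ φ) {n₀ : ℝ}
    (hn₀ : 0 < n₀) :
    ∃ K C : ℝ, 1 ≤ K ∧ 0 < C ∧ ∀ t n, 0 < t → n₀ ≤ n →
      ENNReal.ofReal (Real.exp (-(C * n)))
        ≤ passageMeasure hS t (Ioc (n / φ (n / t)) (K * (n / φ (n / t)))) := by
  obtain ⟨C', hC', hneg⟩ := exp_neg_le_one_sub_passageProb hS hφ hβ hφs
    (A := 2) (by norm_num) hn₀
  obtain ⟨-, -, b₁, b₂, -, -, hs⟩ := hφs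
  have hinv : 0 < 1 / n₀ := by positivity
  refine ⟨1 + C' + 1 / n₀, C' + 1 / n₀, by linarith, by linarith, fun t n ht hn => ?_⟩
  have hn0 : 0 < n := hn₀.trans_le hn
  have hp := hs.pos _ (div_pos hn0 ht)
  refine le_trans (ENNReal.ofReal_le_ofReal ?_) (le_passageMeasure_Ioc hS t (by positivity))
  have h2 := hneg t n (2 * (n / φ (n / t))) ht hn (by positivity) le_rfl
  have h3 := one_sub_passageProb_le hS hφ t (r := (1 + C' + 1 / n₀) * (n / φ (n / t)))
    (by positivity) (div_pos hn0 ht)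
  have hn1 : 1 ≤ 1 / n₀ * n := by rw [one_div_mul_eq_div, one_le_div hn₀]; exact hn
  have e : n / t * t - (1 + C' + 1 / n₀) * (n / φ (n / t)) * φ (n / t)
      = -((C' + 1 / n₀) * n) := by
    rw [mul_assoc, div_mul_cancel₀ _ hp.ne', div_mul_cancel₀ _ ht.ne']; ring
  rw [e] at h3
  have h4 : 2 * Real.exp (-((C' + 1 / n₀) * n)) ≤ Real.exp (-(C' * n)) := by
    have : Real.exp (-(C' * n)) = Real.exp (-((C' + 1 / n₀) * n)) * Real.exp (1 / n₀ * n) := by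
      rw [← Real.exp_add]; ring_nf
    rw [this, mul_comm]
    gcongr
    linarith [Real.add_one_le_exp (1 / n₀ * n)]
  linarith

/-- Chernoff at frequency `n/(ut)`: the gain `lt` is `n/u`, and for `u` large sublinear scaling of
`φ` makes the loss at least `2n/u`. Frequency `n/t` itself would give no decay. -/
theorem exists_passageMeasure_Ioi_le_exp (hS : IsSubordinator S Q) (hφ : HasLaplaceExponent S Q φ)
    (hβ : β₂ < 1) (hφs : WeakScaling β₁ β₂ φ) :
    ∃ c, 0 < c ∧ ∀ t n, 0 < t → 0 < n →
      passageMeasure hS t (Ioi (n / φ (n / t))) ≤ ENNReal.ofReal (Real.exp (-(c * n))) := by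
  obtain ⟨-, -, b₁, b₂, -, hb₂, hs⟩ := hφs
  obtain ⟨u, hu1, hu⟩ := ((Filter.eventually_ge_atTop (1 : ℝ)).and
    ((tendsto_rpow_atTop (sub_pos.2 hβ)).eventually_ge_atTop (2 * b₂))).exists
  have hu0 : 0 < u := by linarith
  refine ⟨u⁻¹, by positivity, fun t n ht hn => ?_⟩
  have hp := hs.pos _ (div_pos hn ht)
  refine (passageMeasure_Ioi_le hS t _).trans (ENNReal.ofReal_le_ofReal ?_)
  have hl : 0 < u⁻¹ * (n / t) := by positivity
  have hl1 : u⁻¹ * (n / t) ≤ n / t :=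
    mul_le_of_le_one_left (by positivity) (inv_le_one_of_one_le₀ hu1)
  refine (one_sub_passageProb_le hS hφ t (by positivity) hl).trans (Real.exp_le_exp.2 ?_)
  have h1 := hs.le_mul hl hl1
  have hp' := hs.pos _ hl
  have e : n / t / (u⁻¹ * (n / t)) = u := by field_simp
  rw [e] at h1
  have h2 : 2 * u⁻¹ * φ (n / t) ≤ φ (u⁻¹ * (n / t)) := by
    rw [Real.rpow_sub hu0, Real.rpow_one, le_div_iff₀ (by positivity)] at hu
    calc 2 * u⁻¹ * φ (n / t) ≤ 2 * u⁻¹ * (b₂ * u ^ β₂ * φ (u⁻¹ * (n / t))) := by gcongr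
      _ = u⁻¹ * (2 * b₂ * u ^ β₂) * φ (u⁻¹ * (n / t)) := by ring
      _ ≤ u⁻¹ * u * φ (u⁻¹ * (n / t)) := by gcongr
      _ = _ := by field_simp
  have h3 : 2 * u⁻¹ * n ≤ n / φ (n / t) * φ (u⁻¹ * (n / t)) := by
    calc 2 * u⁻¹ * n = n / φ (n / t) * (2 * u⁻¹ * φ (n / t)) := by field_simp
      _ ≤ _ := by gcongr
  have e2 : u⁻¹ * (n / t) * t = u⁻¹ * n := by field_simp
  rw [e2]
  linarith

theorem lintegral_passageMeasure_le (hS : IsSubordinator S Q) (t : ℝ) (f : ℝ → ℝ≥0∞) (a : ℝ) :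
    ∫⁻ r, f r ∂(passageMeasure hS t) ≤
      ∫⁻ r in Ioc 0 a, f r ∂(passageMeasure hS t) + ∫⁻ r in Ioi a, f r ∂(passageMeasure hS t) := by
  have e : passageMeasure hS t = (passageMeasure hS t).restrict (Ioi 0) := by
    simp [passageMeasure]
  calc ∫⁻ r, f r ∂(passageMeasure hS t) = ∫⁻ r in Ioi 0, f r ∂(passageMeasure hS t) := by rw [← e]
    _ ≤ ∫⁻ r in Ioc 0 a ∪ Ioi a, f r ∂(passageMeasure hS t) :=
        lintegral_mono_set fun r hr => (le_or_gt r a).imp (fun h => ⟨hr, h⟩) id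
    _ ≤ _ := lintegral_union_le _ _ _

end PassageMeasure

/-! ### Comparison of a measure with Lebesgue measure on doubling profiles -/

section Comparison

/-- Tonelli for the kernel `w(r)/r` on `r < s ≤ Kr`: integrating first in `s` against `ν` gives at
least `k w(r)`, integrating first in `r` gives at most `DK w(s)`. -/
theorem mul_setLIntegral_le_of_le_Ioc {ν : Measure ℝ} [SFinite ν] {w : ℝ → ℝ≥0∞}
    (hw : Measurable w) {a b k D K : ℝ} (ha : 0 ≤ a) (hD : 0 ≤ D) (hK : 1 ≤ K)
    (hν : ∀ r, 0 < r → r ≤ b → ENNReal.ofReal (k * r) ≤ ν (Ioc r (K * r)))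
    (hwD : ∀ r s, 0 < r → r ≤ s → s ≤ K * r → w r ≤ ENNReal.ofReal D * w s) :
    ENNReal.ofReal k * ∫⁻ r in Ioc a b, w r ≤ ENNReal.ofReal (D * K) * ∫⁻ s in Ioi a, w s ∂ν := by
  have hE : MeasurableSet {p : ℝ × ℝ | p.1 < p.2 ∧ p.2 ≤ K * p.1} :=
    (measurableSet_lt measurable_fst measurable_snd).inter
      (measurableSet_le measurable_snd (measurable_fst.const_mul K))
  let f : ℝ × ℝ → ℝ≥0∞ := {p : ℝ × ℝ | p.1 < p.2 ∧ p.2 ≤ K * p.1}.indicator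
    (fun p => w p.1 * ENNReal.ofReal p.1⁻¹)
  have hf : Measurable f :=
    ((hw.comp measurable_fst).mul measurable_fst.inv.ennreal_ofReal).indicator hE
  calc ENNReal.ofReal k * ∫⁻ r in Ioc a b, w r
      = ∫⁻ r in Ioc a b, ENNReal.ofReal k * w r := (lintegral_const_mul _ hw).symm
    _ ≤ ∫⁻ r in Ioc a b, ∫⁻ s in Ioi a, f (r, s) ∂ν := by
        refine setLIntegral_mono' measurableSet_Ioc fun r hr => ?_
        have hr0 : 0 < r := ha.trans_lt hr.1
        have hsub : Ioc r (K * r) ⊆ Ioi a := fun s hs => hr.1.trans hs.1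
        have e : ∀ s, f (r, s)
            = (Ioc r (K * r)).indicator (fun _ => w r * ENNReal.ofReal r⁻¹) s := fun s => rfl
        simp_rw [e]
        rw [lintegral_indicator_const measurableSet_Ioc, Measure.restrict_eq_self _ hsub]
        calc ENNReal.ofReal k * w r
            = w r * ENNReal.ofReal r⁻¹ * ENNReal.ofReal (k * r) := by
              rw [mul_assoc, ← ENNReal.ofReal_mul (by positivity), mul_comm]
              congr 2
              field_simp
          _ ≤ _ := by gcongr; exact hν r hr0 hr.2
    _ = ∫⁻ s in Ioi a, (∫⁻ r in Ioc a b, f (r, s)) ∂ν :=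
        lintegral_lintegral_swap (f := fun r s => f (r, s)) hf.aemeasurable
    _ ≤ ∫⁻ s in Ioi a, ENNReal.ofReal (D * K) * w s ∂ν := by
        refine setLIntegral_mono' measurableSet_Ioi fun s hs => ?_
        have hs0 : 0 < s := ha.trans_lt hs
        calc ∫⁻ r in Ioc a b, f (r, s)
            ≤ ∫⁻ r in Ioc a b, (Ioc 0 s).indicator
                (fun _ => ENNReal.ofReal D * w s * ENNReal.ofReal (K / s)) r := by
              refine setLIntegral_mono' measurableSet_Ioc fun r hr => ?_
              have hr0 : 0 < r := ha.trans_lt hr.1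
              by_cases h : r < s ∧ s ≤ K * r
              · rw [indicator_of_mem (show r ∈ Ioc 0 s from ⟨hr0, h.1.le⟩)]
                simp only [f]
                rw [indicator_of_mem (show (r, s) ∈ {p : ℝ × ℝ | p.1 < p.2 ∧ p.2 ≤ K * p.1} from h)]
                refine mul_le_mul' (hwD r s hr0 h.1.le h.2) (ENNReal.ofReal_le_ofReal ?_)
                rw [inv_eq_one_div, div_le_div_iff₀ hr0 hs0]
                linarith [h.2]
              · simp only [f]
                rw [indicator_of_notMem
                  (show (r, s) ∉ {p : ℝ × ℝ | p.1 < p.2 ∧ p.2 ≤ K * p.1} from h)]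
                exact zero_le
          _ ≤ ∫⁻ r, (Ioc 0 s).indicator
                (fun _ => ENNReal.ofReal D * w s * ENNReal.ofReal (K / s)) r :=
              setLIntegral_le_lintegral _ _
          _ = ENNReal.ofReal (D * K) * w s := by
              rw [lintegral_indicator_const measurableSet_Ioc, Real.volume_Ioc, sub_zero, mul_assoc,
                ← ENNReal.ofReal_mul (by positivity), div_mul_cancel₀ _ hs0.ne',
                ENNReal.ofReal_mul hD]
              ring
    _ = _ := lintegral_const_mul _ hw

/-- The same exchange with the kernel `2D w(r)/r` on `s < r ≤ 2s`: its `r`-integral is at least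
`w(s)`, and its `s`-integral sees only `ν (0,r] ≤ kr`. The reach `r ≤ 2s` is what extends the range
to `2b`. -/
theorem setLIntegral_le_of_Ioc_le {ν : Measure ℝ} [SFinite ν] {w : ℝ → ℝ≥0∞}
    (hw : Measurable w) {a b k D : ℝ} (ha : 0 ≤ a)
    (hν : ∀ r, 0 < r → ν (Ioc 0 r) ≤ ENNReal.ofReal (k * r))
    (hwD : ∀ r s, 0 < r → r ≤ s → s ≤ 2 * r → w r ≤ ENNReal.ofReal D * w s) :
    ∫⁻ s in Ioc a b, w s ∂ν ≤ ENNReal.ofReal (2 * D) * ENNReal.ofReal k *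
      ∫⁻ r in Ioc a (2 * b), w r := by
  have hE : MeasurableSet {p : ℝ × ℝ | p.1 < p.2 ∧ p.2 ≤ 2 * p.1} :=
    (measurableSet_lt measurable_fst measurable_snd).inter
      (measurableSet_le measurable_snd (measurable_fst.const_mul 2))
  let f : ℝ × ℝ → ℝ≥0∞ := {p : ℝ × ℝ | p.1 < p.2 ∧ p.2 ≤ 2 * p.1}.indicator
    (fun p => ENNReal.ofReal D * w p.2 * ENNReal.ofReal (2 / p.2))
  have hf : Measurable f :=
    (((hw.comp measurable_snd).const_mul _).mul
      (measurable_const.div measurable_snd).ennreal_ofReal).indicator hE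
  calc ∫⁻ s in Ioc a b, w s ∂ν
      ≤ ∫⁻ s in Ioc a b, (∫⁻ r in Ioc a (2 * b), f (s, r)) ∂ν := by
        refine setLIntegral_mono' measurableSet_Ioc fun s hs => ?_
        have hs0 : 0 < s := ha.trans_lt hs.1
        have hsub : Ioc s (2 * s) ⊆ Ioc a (2 * b) := fun r hr =>
          ⟨hs.1.trans hr.1, hr.2.trans (by linarith [hs.2])⟩
        calc w s = ∫⁻ r in Ioc a (2 * b), (Ioc s (2 * s)).indicator
                (fun _ => w s * ENNReal.ofReal s⁻¹) r := by
              rw [lintegral_indicator_const measurableSet_Ioc, Measure.restrict_eq_self _ hsub,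
                Real.volume_Ioc, mul_assoc, ← ENNReal.ofReal_mul (by positivity),
                show s⁻¹ * (2 * s - s) = 1 by field_simp; ring, ENNReal.ofReal_one, mul_one]
          _ ≤ ∫⁻ r in Ioc a (2 * b), f (s, r) := by
              refine lintegral_mono fun r => ?_
              by_cases h : r ∈ Ioc s (2 * s)
              · rw [indicator_of_mem h]
                simp only [f]
                rw [indicator_of_mem (show (s, r) ∈ {p : ℝ × ℝ | p.1 < p.2 ∧ p.2 ≤ 2 * p.1} from h)]
                refine mul_le_mul' (hwD s r hs0 h.1.le h.2) (ENNReal.ofReal_le_ofReal ?_)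
                rw [inv_eq_one_div, div_le_div_iff₀ hs0 (hs0.trans h.1)]
                linarith [h.2]
              · rw [indicator_of_notMem h]
                exact zero_le
    _ = ∫⁻ r in Ioc a (2 * b), ∫⁻ s in Ioc a b, f (s, r) ∂ν :=
        lintegral_lintegral_swap (f := fun s r => f (s, r)) hf.aemeasurable
    _ ≤ ∫⁻ r in Ioc a (2 * b), ENNReal.ofReal (2 * D) * ENNReal.ofReal k * w r := by
        refine setLIntegral_mono' measurableSet_Ioc fun r hr => ?_
        have hr0 : 0 < r := ha.trans_lt hr.1
        calc ∫⁻ s in Ioc a b, f (s, r) ∂ν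
            ≤ ∫⁻ s in Ioc a b, (Ioc 0 r).indicator
                (fun _ => ENNReal.ofReal D * w r * ENNReal.ofReal (2 / r)) s ∂ν := by
              refine setLIntegral_mono' measurableSet_Ioc fun s hs => ?_
              by_cases h : s < r ∧ r ≤ 2 * s
              · rw [indicator_of_mem (show s ∈ Ioc 0 r from ⟨ha.trans_lt hs.1, h.1.le⟩)]
                simp only [f]
                rw [indicator_of_mem (show (s, r) ∈ {p : ℝ × ℝ | p.1 < p.2 ∧ p.2 ≤ 2 * p.1} from h)]
              · simp only [f]
                rw [indicator_of_notMem
                  (show (s, r) ∉ {p : ℝ × ℝ | p.1 < p.2 ∧ p.2 ≤ 2 * p.1} from h)]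
                exact zero_le
          _ ≤ ∫⁻ s, (Ioc 0 r).indicator
                (fun _ => ENNReal.ofReal D * w r * ENNReal.ofReal (2 / r)) s ∂ν :=
              setLIntegral_le_lintegral _ _
          _ ≤ ENNReal.ofReal D * w r * ENNReal.ofReal (2 / r) * ENNReal.ofReal (k * r) := by
              rw [lintegral_indicator_const measurableSet_Ioc]
              gcongr
              exact hν r hr0
          _ = ENNReal.ofReal (2 * D) * ENNReal.ofReal k * w r := by
              rw [mul_assoc, ← ENNReal.ofReal_mul (by positivity),
                show 2 / r * (k * r) = 2 * k by field_simp, ENNReal.ofReal_mul zero_le_two,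
                ENNReal.ofReal_mul zero_le_two]
              ring
    _ = _ := lintegral_const_mul _ hw

/-- The substitution `r ↦ r / l` on intervals. -/
theorem setLIntegral_Ioc_comp_div {w : ℝ → ℝ≥0∞} (hw : Measurable w) {l : ℝ} (hl : 0 < l)
    (a b : ℝ) :
    ∫⁻ r in Ioc (a * l) b, w (r / l) = ENNReal.ofReal l * ∫⁻ r in Ioc a (b / l), w r := by
  rw [← lintegral_indicator measurableSet_Ioc, ← lintegral_indicator measurableSet_Ioc]
  have h : ∀ g : ℝ → ℝ≥0∞, Measurable g →
      ∫⁻ r, g r = ENNReal.ofReal l⁻¹ * ∫⁻ r, g (r * l⁻¹) := fun g hg => by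
    conv_lhs => rw [← Real.smul_map_volume_mul_right (a := l⁻¹) (by positivity)]
    rw [lintegral_smul_measure, lintegral_map hg (measurable_mul_const _), smul_eq_mul,
      abs_of_pos (by positivity)]
  rw [h _ (hw.indicator measurableSet_Ioc), ← mul_assoc, ← ENNReal.ofReal_mul hl.le,
    mul_inv_cancel₀ hl.ne', ENNReal.ofReal_one, one_mul]
  refine lintegral_congr fun r => ?_
  have hiff : r ∈ Ioc (a * l) b ↔ r * l⁻¹ ∈ Ioc a (b / l) := by
    rw [mem_Ioc, mem_Ioc, ← div_eq_mul_inv, lt_div_iff₀ hl, div_le_div_iff_of_pos_right hl]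
  by_cases hr : r ∈ Ioc (a * l) b
  · rw [indicator_of_mem hr, indicator_of_mem (hiff.1 hr), div_eq_mul_inv]
  · rw [indicator_of_notMem hr, indicator_of_notMem (hiff.not.1 hr)]

end Comparison

/-! ### Estimates of the fundamental solution -/

section FundamentalSolution

theorem IsScale.dist_pos_of_one_le {M : Type*} [MetricSpace M] {α₁ α₂ : ℝ} {φ Φ : ℝ → ℝ}
    (hΦ : IsScale α₁ α₂ Φ) {t : ℝ} {x y : M}
    (h : 1 ≤ Φ (dist x y) * φ t⁻¹) : 0 < dist x y := by
  rcases (dist_nonneg (x := x) (y := y)).eq_or_lt with h0 | h0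
  · rw [← h0, hΦ.zero, zero_mul] at h
    exact absurd h (by norm_num)
  · exact h0

variable {M : Type*} [MetricSpace M] [MeasurableSpace M] {μ : Measure M}
  {Ω : Type*} [MeasurableSpace Ω] {S : ℝ≥0 → Ω → ℝ} {Q : Measure Ω} [IsProbabilityMeasure Q]
  {φ Φ : ℝ → ℝ} {m n : ℝ → ℝ → ℝ} {q : ℝ → M → M → ℝ} {α₁ α₂ β₁ β₂ d₁ d₂ : ℝ}

theorem SubGaussianEstimate.exists_profile_bounds (h : SubGaussianEstimate μ Φ m q) :
    ∃ C₁ c₁ C₂ c₂ : ℝ, 0 < C₁ ∧ 0 < c₁ ∧ 0 < C₂ ∧ 0 < c₂ ∧ ∀ (t : ℝ) (x y : M), 0 < t →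
      C₁ * profile μ Φ x t * Real.exp (-(c₁ * m t (dist x y))) ≤ q t x y ∧
      q t x y ≤ C₂ * profile μ Φ x t * Real.exp (-(c₂ * m t (dist x y))) := by
  simpa only [SubGaussianEstimate, profile, mul_one_div] using h

theorem IsScale.nonneg (hΦ : IsScale α₁ α₂ Φ) {r : ℝ} (hr : 0 ≤ r) : 0 ≤ Φ r := by
  rcases hr.eq_or_lt with rfl | hr
  · exact hΦ.zero.ge
  · exact (hΦ.pos hr).le

/-- `r ↦ 1 / V(x, Φ⁻¹(r))` is comparable to its values at comparable points. -/
theorem exists_profile_le_of_le_mul (hV : UniformWeakScaling d₁ d₂ (vol μ)) (hΦ : IsScale α₁ α₂ Φ)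
    (K : ℝ) : ∃ D, 0 < D ∧ ∀ (x : M) (r s : ℝ), 0 < r → r ≤ s → s ≤ K * r →
      profile μ Φ x r ≤ D * profile μ Φ x s := by
  obtain ⟨A, p, hA, hp, hw⟩ := profile_scaling hV hΦ
  refine ⟨A * max 1 K ^ p, by positivity, fun x r s hr hrs hsK => (hw x r s hr hrs).trans ?_⟩
  have h0 := profile_nonneg (μ := μ) (Φ := Φ) x s
  have h1 : 0 ≤ s / r := div_nonneg (hr.le.trans hrs) hr.le
  gcongr
  exact ((div_le_iff₀ hr).2 hsK).trans (le_max_right _ _)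

/-- Near the diagonal the fundamental solution dominates the integrated profile. -/
theorem le_fundSol_near (hV : UniformWeakScaling d₁ d₂ (vol μ)) (hS : IsSubordinator S Q)
    (hφ : HasLaplaceExponent S Q φ) (hβ : β₂ < 1) (hφs : WeakScaling β₁ β₂ φ) (hα : 1 < α₁)
    (hΦ : IsScale α₁ α₂ Φ) (hm : IsDiffusionExponent Φ m) (hest : SubGaussianEstimate μ Φ m q) :
    ∃ c, 0 < c ∧ ∀ (t : ℝ) (x y : M), 0 < t →
      ENNReal.ofReal c * (ENNReal.ofReal (φ t⁻¹) *
        ∫⁻ r in Ioc (Φ (dist x y)) (2 / φ t⁻¹), ENNReal.ofReal (profile μ Φ x r))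
        ≤ fundSol hS q t x y := by
  obtain ⟨C₁, c₁, C₂, c₂, hC₁, hc₁, hC₂, hc₂, hq⟩ := hest.exists_profile_bounds
  obtain ⟨B, hB, hmB⟩ := hm.bounded hΦ hα
  obtain ⟨K, k, hK, hk, hmass⟩ := exists_le_passageMeasure_Ioc hS hφ hβ hφs
  obtain ⟨D, hD, hDw⟩ := exists_profile_le_of_le_mul hV hΦ K
  obtain ⟨-, -, b₁, b₂, -, -, hs⟩ := hφs
  -- For `r ≥ Φ(d)` the exponent is at most `B`, so `q` is at least `L` times the profile there.
  set L := C₁ * Real.exp (-(c₁ * B)) with hL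
  have hL0 : 0 < L := by positivity
  refine ⟨L * (D * K)⁻¹ * k, by positivity, fun t x y ht => ?_⟩
  have hl := hs.pos t⁻¹ (by positivity)
  have hd : 0 ≤ Φ (dist x y) := hΦ.nonneg dist_nonneg
  have hw := (measurable_profile hV hΦ x).ennreal_ofReal
  have key := mul_setLIntegral_le_of_le_Ioc (ν := passageMeasure hS t) hw (a := Φ (dist x y))
    (b := 2 / φ t⁻¹) (k := k * φ t⁻¹) hd hD.le hK
    (fun r hr hrb => hmass t r ht hr ((le_div_iff₀ hl).1 hrb))
    (fun r s hr hrs hsK => by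
      rw [← ENNReal.ofReal_mul hD.le]
      exact ENNReal.ofReal_le_ofReal (hDw x r s hr hrs hsK))
  have hDK : 0 < D * K := by positivity
  calc ENNReal.ofReal (L * (D * K)⁻¹ * k) * (ENNReal.ofReal (φ t⁻¹) *
        ∫⁻ r in Ioc (Φ (dist x y)) (2 / φ t⁻¹), ENNReal.ofReal (profile μ Φ x r))
      = ENNReal.ofReal L * (ENNReal.ofReal (D * K)⁻¹ * (ENNReal.ofReal (k * φ t⁻¹) *
        ∫⁻ r in Ioc (Φ (dist x y)) (2 / φ t⁻¹), ENNReal.ofReal (profile μ Φ x r))) := by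
        rw [ENNReal.ofReal_mul (by positivity), ENNReal.ofReal_mul hL0.le, ENNReal.ofReal_mul hk.le]
        ring
    _ ≤ ENNReal.ofReal L * (ENNReal.ofReal (D * K)⁻¹ * (ENNReal.ofReal (D * K) *
        ∫⁻ r in Ioi (Φ (dist x y)), ENNReal.ofReal (profile μ Φ x r) ∂(passageMeasure hS t))) := by
        gcongr
    _ = ∫⁻ r in Ioi (Φ (dist x y)), ENNReal.ofReal L * ENNReal.ofReal (profile μ Φ x r)
          ∂(passageMeasure hS t) := by
        rw [← mul_assoc (ENNReal.ofReal (D * K)⁻¹), ← ENNReal.ofReal_mul (by positivity),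
          inv_mul_cancel₀ hDK.ne', ENNReal.ofReal_one, one_mul, lintegral_const_mul _ hw]
    _ ≤ ∫⁻ r in Ioi (Φ (dist x y)), ENNReal.ofReal (q r x y) ∂(passageMeasure hS t) := by
        refine setLIntegral_mono' measurableSet_Ioi fun r hr => ?_
        have hr0 : 0 < r := hd.trans_lt hr
        rw [← ENNReal.ofReal_mul hL0.le]
        refine ENNReal.ofReal_le_ofReal (le_trans ?_ (hq r x y hr0).1)
        have h1 := hmB r (dist x y) hr0 dist_nonneg (mem_Ioi.1 hr).le
        have h0 := profile_nonneg (μ := μ) (Φ := Φ) x r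
        calc L * profile μ Φ x r = C₁ * profile μ Φ x r * Real.exp (-(c₁ * B)) := by
              rw [hL]; ring
          _ ≤ _ := by gcongr
    _ ≤ _ := setLIntegral_le_lintegral _ _

/-- Near the diagonal the fundamental solution is dominated by the integrated profile. -/
theorem fundSol_near_le (hV : UniformWeakScaling d₁ d₂ (vol μ)) (hS : IsSubordinator S Q)
    (hφ : HasLaplaceExponent S Q φ) (hφs : WeakScaling β₁ β₂ φ) (hα : 1 < α₁)
    (hΦ : IsScale α₁ α₂ Φ) (hm : IsDiffusionExponent Φ m) (hest : SubGaussianEstimate μ Φ m q) :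
    ∃ c, 0 < c ∧ ∀ (t : ℝ) (x y : M), 0 < t → Φ (dist x y) * φ t⁻¹ ≤ 1 →
      fundSol hS q t x y ≤ ENNReal.ofReal c * (ENNReal.ofReal (φ t⁻¹) *
        ∫⁻ r in Ioc (Φ (dist x y)) (2 / φ t⁻¹), ENNReal.ofReal (profile μ Φ x r)) := by
  obtain ⟨C₁, c₁, C₂, c₂, hC₁, hc₁, hC₂, hc₂, hq⟩ := hest.exists_profile_bounds
  obtain ⟨A, hA, hAw⟩ := profile_mul_exp_le hV hm hΦ hα hc₂
  obtain ⟨D, hD, hDw⟩ := exists_profile_le_of_le_mul hV hΦ 2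
  obtain ⟨-, -, b₁, b₂, -, -, hs⟩ := hφs
  set e₁ := 2 * (1 - Real.exp (-1))⁻¹ with he₁
  have h0 : 0 < e₁ := mul_pos two_pos (inv_pos.2 one_sub_exp_neg_one_pos)
  -- One summand for each range of times: up to `Φ(d)`, from there to `1/φ(1/t)`, and beyond.
  refine ⟨C₂ * A * e₁ * D + C₂ * (2 * D * e₁) + C₂ * D, by positivity,
    fun t x y ht hxy => ?_⟩
  have hl := hs.pos t⁻¹ (by positivity)
  have hd : 0 ≤ Φ (dist x y) := hΦ.nonneg dist_nonneg
  have hw := (measurable_profile hV hΦ x).ennreal_ofReal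
  have hxy' : Φ (dist x y) ≤ 1 / φ t⁻¹ := (le_div_iff₀ hl).2 hxy
  set ν := passageMeasure hS t with hν
  set I := ∫⁻ r in Ioc (Φ (dist x y)) (2 / φ t⁻¹), ENNReal.ofReal (profile μ Φ x r) with hI
  have hq' : ∀ r, 0 < r → q r x y ≤ C₂ * profile μ Φ x r := fun r hr => by
    refine (hq r x y hr).2.trans (mul_le_of_le_one_right
      (mul_nonneg hC₂.le (profile_nonneg x r)) (Real.exp_le_one_iff.2 ?_))
    have := mul_nonneg hc₂.le (hm.nonneg hr (dist_nonneg (x := x) (y := y)))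
    linarith
  -- The block `(u,2u]` alone carries at least `u/D` times the profile at `u`. The upper limit 2 in
  -- the theorem leaves room for it up to `u = 1/φ(1/t)`, so both outer ranges can be charged to the
  -- integral.
  have hblock : ∀ u, 0 < u → Φ (dist x y) ≤ u → 2 * u ≤ 2 / φ t⁻¹ →
      ENNReal.ofReal (u * profile μ Φ x u) ≤ ENNReal.ofReal D * I := by
    intro u hu hdu hul
    calc ENNReal.ofReal (u * profile μ Φ x u)
        ≤ ENNReal.ofReal (D * (profile μ Φ x (2 * u) * (2 * u - u))) := by
          refine ENNReal.ofReal_le_ofReal ?_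
          have := mul_le_mul_of_nonneg_left
            (hDw x u (2 * u) hu (by linarith) le_rfl) hu.le
          linarith
      _ = ENNReal.ofReal D *
            ∫⁻ _ in Ioc u (2 * u), ENNReal.ofReal (profile μ Φ x (2 * u)) := by
          rw [setLIntegral_const, Real.volume_Ioc, ENNReal.ofReal_mul hD.le,
            ENNReal.ofReal_mul (profile_nonneg _ _)]
      _ ≤ ENNReal.ofReal D * ∫⁻ r in Ioc u (2 * u), ENNReal.ofReal (profile μ Φ x r) := by
          refine mul_le_mul_right (setLIntegral_mono' measurableSet_Ioc fun r hr => ?_) _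
          exact ENNReal.ofReal_le_ofReal (profile_anti hV hΦ x (hu.trans hr.1) hr.2)
      _ ≤ _ := by
          gcongr
          exact lintegral_mono_set (Ioc_subset_Ioc hdu hul)
  have hsmall : ∫⁻ r in Ioc 0 (Φ (dist x y)), ENNReal.ofReal (q r x y) ∂ν
      ≤ ENNReal.ofReal (C₂ * A * e₁ * D) * (ENNReal.ofReal (φ t⁻¹) * I) := by
    rcases hd.eq_or_lt with hd0 | hd0
    · rw [← hd0, Ioc_self, Measure.restrict_empty, lintegral_zero_measure]
      exact zero_le
    have hdist : 0 < dist x y := by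
      rcases (dist_nonneg (x := x) (y := y)).eq_or_lt with h | h
      · rw [← h, hΦ.zero] at hd0; exact absurd hd0 (lt_irrefl _)
      · exact h
    calc ∫⁻ r in Ioc 0 (Φ (dist x y)), ENNReal.ofReal (q r x y) ∂ν
        ≤ ∫⁻ _ in Ioc 0 (Φ (dist x y)),
            ENNReal.ofReal (C₂ * A * profile μ Φ x (Φ (dist x y))) ∂ν := by
          refine setLIntegral_mono' measurableSet_Ioc fun r hr => ENNReal.ofReal_le_ofReal ?_
          have h1 := mul_le_mul_of_nonneg_left (hAw x r _ hr.1 hdist hr.2) hC₂.le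
          have h2 := (hq r x y hr.1).2
          linarith
      _ ≤ ENNReal.ofReal (C₂ * A * profile μ Φ x (Φ (dist x y))) *
            ENNReal.ofReal (e₁ * φ t⁻¹ * Φ (dist x y)) := by
          rw [setLIntegral_const]
          gcongr
          exact passageMeasure_Ioc_zero_le hS hφ ht hd0
      _ = ENNReal.ofReal (C₂ * A * e₁) * (ENNReal.ofReal (φ t⁻¹) *
            ENNReal.ofReal (Φ (dist x y) * profile μ Φ x (Φ (dist x y)))) := by
          have hp := profile_nonneg (μ := μ) (Φ := Φ) x (Φ (dist x y))
          rw [← ENNReal.ofReal_mul (by positivity), ← ENNReal.ofReal_mul hl.le,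
            ← ENNReal.ofReal_mul (by positivity)]
          ring_nf
      _ ≤ ENNReal.ofReal (C₂ * A * e₁) * (ENNReal.ofReal (φ t⁻¹) * (ENNReal.ofReal D * I)) := by
          gcongr
          refine hblock _ hd0 le_rfl ?_
          rw [le_div_iff₀ hl]
          linarith
      _ = _ := by
          rw [ENNReal.ofReal_mul (p := C₂ * A * e₁) (by positivity)]
          ring
  have hmid : ∫⁻ r in Ioc (Φ (dist x y)) (1 / φ t⁻¹), ENNReal.ofReal (q r x y) ∂ν
      ≤ ENNReal.ofReal (C₂ * (2 * D * e₁)) * (ENNReal.ofReal (φ t⁻¹) * I) := by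
    have key := setLIntegral_le_of_Ioc_le (ν := ν) hw (a := Φ (dist x y))
      (b := 1 / φ t⁻¹) (k := e₁ * φ t⁻¹) (D := D) hd
      (fun r hr => passageMeasure_Ioc_zero_le hS hφ ht hr)
      (fun r s hr hrs hsK => by
        rw [← ENNReal.ofReal_mul hD.le]
        exact ENNReal.ofReal_le_ofReal (hDw x r s hr hrs hsK))
    rw [mul_one_div] at key
    calc ∫⁻ r in Ioc (Φ (dist x y)) (1 / φ t⁻¹), ENNReal.ofReal (q r x y) ∂ν
        ≤ ∫⁻ r in Ioc (Φ (dist x y)) (1 / φ t⁻¹),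
            ENNReal.ofReal C₂ * ENNReal.ofReal (profile μ Φ x r) ∂ν := by
          refine setLIntegral_mono' measurableSet_Ioc fun r hr => ?_
          rw [← ENNReal.ofReal_mul hC₂.le]
          exact ENNReal.ofReal_le_ofReal (hq' r (hd.trans_lt hr.1))
      _ ≤ ENNReal.ofReal C₂ * (ENNReal.ofReal (2 * D) * ENNReal.ofReal (e₁ * φ t⁻¹) * I) := by
          rw [lintegral_const_mul _ hw]
          gcongr
      _ = _ := by
          rw [ENNReal.ofReal_mul h0.le, ENNReal.ofReal_mul hC₂.le,
            ENNReal.ofReal_mul (p := 2 * D) (by positivity)]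
          ring
  have hlarge : ∫⁻ r in Ioi (1 / φ t⁻¹), ENNReal.ofReal (q r x y) ∂ν
      ≤ ENNReal.ofReal (C₂ * D) * (ENNReal.ofReal (φ t⁻¹) * I) := by
    have hl' : 0 < 1 / φ t⁻¹ := by positivity
    have hp := profile_nonneg (μ := μ) (Φ := Φ) x (1 / φ t⁻¹)
    calc ∫⁻ r in Ioi (1 / φ t⁻¹), ENNReal.ofReal (q r x y) ∂ν
        ≤ ∫⁻ _ in Ioi (1 / φ t⁻¹), ENNReal.ofReal (C₂ * profile μ Φ x (1 / φ t⁻¹)) ∂ν := by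
          refine setLIntegral_mono' measurableSet_Ioi fun r hr => ENNReal.ofReal_le_ofReal ?_
          have hr' := mem_Ioi.1 hr
          exact (hq' r (hl'.trans hr')).trans
            (mul_le_mul_of_nonneg_left (profile_anti hV hΦ x hl' hr'.le) hC₂.le)
      _ ≤ ENNReal.ofReal (C₂ * profile μ Φ x (1 / φ t⁻¹)) * 1 := by
          rw [setLIntegral_const]
          gcongr
          exact passageMeasure_le_one hS t _
      _ = ENNReal.ofReal C₂ * (ENNReal.ofReal (φ t⁻¹) *
            ENNReal.ofReal (1 / φ t⁻¹ * profile μ Φ x (1 / φ t⁻¹))) := by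
          rw [mul_one, ← ENNReal.ofReal_mul hl.le, ← ENNReal.ofReal_mul hC₂.le]
          rw [← mul_assoc (φ t⁻¹), mul_one_div, div_self hl.ne', one_mul]
      _ ≤ ENNReal.ofReal C₂ * (ENNReal.ofReal (φ t⁻¹) * (ENNReal.ofReal D * I)) := by
          gcongr
          exact hblock _ hl' hxy' (by rw [mul_one_div])
      _ = _ := by
          rw [ENNReal.ofReal_mul hC₂.le]
          ring
  calc fundSol hS q t x y
      ≤ ∫⁻ r in Ioc 0 (Φ (dist x y)), ENNReal.ofReal (q r x y) ∂ν
          + ∫⁻ r in Ioi (Φ (dist x y)), ENNReal.ofReal (q r x y) ∂ν :=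
        lintegral_passageMeasure_le hS t _ _
    _ ≤ ∫⁻ r in Ioc 0 (Φ (dist x y)), ENNReal.ofReal (q r x y) ∂ν
          + (∫⁻ r in Ioc (Φ (dist x y)) (1 / φ t⁻¹), ENNReal.ofReal (q r x y) ∂ν
          + ∫⁻ r in Ioi (1 / φ t⁻¹), ENNReal.ofReal (q r x y) ∂ν) := by
        gcongr
        rw [← Ioc_union_Ioi_eq_Ioi hxy']
        exact lintegral_union_le _ _ _
    _ ≤ ENNReal.ofReal (C₂ * A * e₁ * D) * (ENNReal.ofReal (φ t⁻¹) * I)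
          + (ENNReal.ofReal (C₂ * (2 * D * e₁)) * (ENNReal.ofReal (φ t⁻¹) * I)
          + ENNReal.ofReal (C₂ * D) * (ENNReal.ofReal (φ t⁻¹) * I)) := by gcongr
    _ = _ := by
        rw [ENNReal.ofReal_add (by positivity) (by positivity),
          ENNReal.ofReal_add (by positivity) (by positivity)]
        ring

/-- At the time `n / φ(n/t)` the diffusion exponent is comparable to the fractional exponent. -/
theorem IsFractionalExponent.compare (hn : IsFractionalExponent φ Φ n)
    (hφs : WeakScaling β₁ β₂ φ) (hα : 1 < α₁) (hΦ : IsScale α₁ α₂ Φ)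
    (hm : IsDiffusionExponent Φ m) :
    ∃ C, 0 < C ∧ ∀ t r, 0 < t → 0 < r →
      n t r ≤ C * m (n t r / φ (n t r / t)) r ∧ m (n t r / φ (n t r / t)) r ≤ C * n t r := by
  obtain ⟨-, -, b₁, b₂, -, -, hsφ⟩ := hφs
  obtain ⟨-, -, c₁, c₂, hc₁, -, hs⟩ := hΦ.scaling
  obtain ⟨k₁, k₂, hk₁, hk₂, hk⟩ := hn.scale
  obtain ⟨l₁, l₂, hl₁, hl₂, hl⟩ := hm.scale
  obtain ⟨C, hC, h⟩ := exponent_le_mul hs hc₁ hα k₂ hl₁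
  obtain ⟨C', hC', h'⟩ := exponent_le_mul hs hc₁ hα l₂ hk₁
  refine ⟨max C C', by positivity, fun t r ht hr => ?_⟩
  have hn0 := hn.pos t r ht hr
  have hp := hsφ.pos _ (div_pos hn0 ht)
  set s := n t r / φ (n t r / t) with hs'
  have hs0 : 0 < s := by positivity
  have hm0 := hm.pos s r hs0 hr
  -- This identity makes the equation for `n(t,r)` the one for `m(s,r)`, so both are approximate
  -- solutions of the same equation.
  have e : s / n t r = 1 / φ (n t r / t) := by rw [hs']; field_simp
  constructor
  · refine (h s r _ _ hs0 hr hm0 hn0 (hl s r hs0 hr).1 ?_).trans ?_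
    · rw [e]; exact (hk t r ht hr).2
    · gcongr; exact le_max_left _ _
  · refine (h' s r _ _ hs0 hr hn0 hm0 ?_ (hl s r hs0 hr).2).trans ?_
    · rw [e]; exact (hk t r ht hr).1
    · gcongr; exact le_max_right _ _

/-- Half of the exponent in `q` brings the profile down to its value at `1/φ(1/t)`; the other half
remains. With `s = n/φ(n/t)`, for `r ≤ s` it is at least a multiple of `n`, because `m` decreases in
time; for `r > s` the passage tail supplies `e^{-kn}`. -/
theorem fundSol_off_diagonal_le (hV : UniformWeakScaling d₁ d₂ (vol μ)) (hS : IsSubordinator S Q)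
    (hφ : HasLaplaceExponent S Q φ) (hβ : β₂ < 1) (hφs : WeakScaling β₁ β₂ φ) (hα : 1 < α₁)
    (hΦ : IsScale α₁ α₂ Φ) (hm : IsDiffusionExponent Φ m) (hest : SubGaussianEstimate μ Φ m q)
    (hn : IsFractionalExponent φ Φ n) :
    ∃ C c : ℝ, 0 < C ∧ 0 < c ∧ ∀ (t : ℝ) (x y : M), 0 < t → 1 ≤ Φ (dist x y) * φ t⁻¹ →
      fundSol hS q t x y
        ≤ ENNReal.ofReal (C * profile μ Φ x (1 / φ t⁻¹) * Real.exp (-(c * n t (dist x y)))) := by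
  obtain ⟨C₁, c₁, C₂, c₂, hC₁, hc₁, hC₂, hc₂, hq⟩ := hest.exists_profile_bounds
  obtain ⟨A, hA, hAw⟩ := profile_mul_exp_le hV hm hΦ hα (half_pos hc₂)
  obtain ⟨B, hB, hcmp⟩ := hn.compare hφs hα hΦ hm
  obtain ⟨k, hk, htail⟩ := exists_passageMeasure_Ioi_le_exp hS hφ hβ hφs
  obtain ⟨-, -, b₁, b₂, -, -, hs⟩ := hφs
  set c := min (c₂ / 2 / B) k with hc
  have hc0 : 0 < c := by positivity
  refine ⟨2 * (C₂ * max 1 A), c, by positivity, hc0, fun t x y ht hxy => ?_⟩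
  have hd := hΦ.dist_pos_of_one_le hxy
  have hl := hs.pos t⁻¹ (by positivity)
  have hl' : 0 < 1 / φ t⁻¹ := by positivity
  have hlΦ : 1 / φ t⁻¹ ≤ Φ (dist x y) := (div_le_iff₀ hl).2 hxy
  set d := dist x y with hd'
  have hn0 := hn.pos t d ht hd
  set N := n t d with hN
  set ν := passageMeasure hS t with hν
  set s := N / φ (N / t) with hs'
  have hs0 : 0 < s := div_pos hn0 (hs.pos _ (div_pos hn0 ht))
  set W := profile μ Φ x (1 / φ t⁻¹) with hW
  have hW0 : 0 ≤ W := profile_nonneg _ _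
  have hqr : ∀ r, 0 < r → q r x y ≤ C₂ * max 1 A * W * Real.exp (-(c₂ / 2 * m r d)) := by
    intro r hr
    have hmr := hm.nonneg hr hd.le
    have h1 : profile μ Φ x r * Real.exp (-(c₂ / 2 * m r d)) ≤ max 1 A * W := by
      rcases le_total r (Φ d) with hrd | hrd
      · calc profile μ Φ x r * Real.exp (-(c₂ / 2 * m r d)) ≤ A * profile μ Φ x (Φ d) :=
              hAw x r d hr hd hrd
          _ ≤ max 1 A * W :=
              mul_le_mul (le_max_right _ _) (profile_anti hV hΦ x hl' hlΦ)
                (profile_nonneg _ _) (by positivity)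
      · calc profile μ Φ x r * Real.exp (-(c₂ / 2 * m r d)) ≤ profile μ Φ x r * 1 := by
              have := profile_nonneg (μ := μ) (Φ := Φ) x r
              gcongr
              exact Real.exp_le_one_iff.2 (by nlinarith)
          _ ≤ 1 * W := by
              rw [mul_one, one_mul]
              exact profile_anti hV hΦ x hl' (hlΦ.trans hrd)
          _ ≤ max 1 A * W := by gcongr; exact le_max_left _ _
    have e : Real.exp (-(c₂ * m r d))
        = Real.exp (-(c₂ / 2 * m r d)) * Real.exp (-(c₂ / 2 * m r d)) := by
      rw [← Real.exp_add]; ring_nf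
    have h2 := (hq r x y hr).2
    rw [← hd', e] at h2
    calc q r x y ≤ _ := h2
      _ = C₂ * (profile μ Φ x r * Real.exp (-(c₂ / 2 * m r d))) *
            Real.exp (-(c₂ / 2 * m r d)) := by ring
      _ ≤ C₂ * (max 1 A * W) * Real.exp (-(c₂ / 2 * m r d)) := by gcongr
      _ = _ := by ring
  have hsmall : ∫⁻ r in Ioc 0 s, ENNReal.ofReal (q r x y) ∂ν
      ≤ ENNReal.ofReal (C₂ * max 1 A * W * Real.exp (-(c * N))) := by
    calc ∫⁻ r in Ioc 0 s, ENNReal.ofReal (q r x y) ∂ν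
        ≤ ∫⁻ _ in Ioc 0 s, ENNReal.ofReal (C₂ * max 1 A * W * Real.exp (-(c * N))) ∂ν := by
          refine setLIntegral_mono' measurableSet_Ioc fun r hr => ENNReal.ofReal_le_ofReal ?_
          refine (hqr r hr.1).trans ?_
          have h1 : N ≤ B * m r d :=
            (hcmp t d ht hd).1.trans (mul_le_mul_of_nonneg_left (hm.le_of_le hr.1 hr.2 hd.le) hB.le)
          have h2 : c * N ≤ c₂ / 2 * m r d :=
            calc c * N ≤ c₂ / 2 / B * (B * m r d) :=
                  mul_le_mul (min_le_left _ _) h1 hn0.le (by positivity)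
              _ = _ := by field_simp
          gcongr
      _ ≤ ENNReal.ofReal (C₂ * max 1 A * W * Real.exp (-(c * N))) * 1 := by
          rw [setLIntegral_const]
          gcongr
          exact passageMeasure_le_one hS t _
      _ = _ := mul_one _
  have hlarge : ∫⁻ r in Ioi s, ENNReal.ofReal (q r x y) ∂ν
      ≤ ENNReal.ofReal (C₂ * max 1 A * W * Real.exp (-(c * N))) := by
    calc ∫⁻ r in Ioi s, ENNReal.ofReal (q r x y) ∂ν
        ≤ ∫⁻ _ in Ioi s, ENNReal.ofReal (C₂ * max 1 A * W) ∂ν := by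
          refine setLIntegral_mono' measurableSet_Ioi fun r hr => ENNReal.ofReal_le_ofReal ?_
          have hr0 : 0 < r := hs0.trans hr
          have hmr := hm.nonneg hr0 hd.le
          exact (hqr r hr0).trans (mul_le_of_le_one_right (by positivity)
            (Real.exp_le_one_iff.2 (by nlinarith)))
      _ ≤ ENNReal.ofReal (C₂ * max 1 A * W) * ENNReal.ofReal (Real.exp (-(c * N))) := by
          rw [setLIntegral_const]
          gcongr
          refine (htail t N ht hn0).trans (ENNReal.ofReal_le_ofReal ?_)
          have : c * N ≤ k * N := mul_le_mul_of_nonneg_right (min_le_right _ _) hn0.le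
          gcongr
      _ = _ := (ENNReal.ofReal_mul (by positivity)).symm
  calc fundSol hS q t x y
      ≤ ∫⁻ r in Ioc 0 s, ENNReal.ofReal (q r x y) ∂ν + ∫⁻ r in Ioi s, ENNReal.ofReal (q r x y) ∂ν :=
        lintegral_passageMeasure_le hS t _ _
    _ ≤ _ := add_le_add hsmall hlarge
    _ = _ := by
        rw [← ENNReal.ofReal_add (by positivity) (by positivity)]
        ring_nf

/-- Only times in `(s,Ks]`, `s = n/φ(n/t)`, are kept: their mass is at least `e^{-Cn}`, and there
`m` is at most a multiple of `n`. -/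
theorem le_fundSol_off_diagonal (hV : UniformWeakScaling d₁ d₂ (vol μ)) (hS : IsSubordinator S Q)
    (hφ : HasLaplaceExponent S Q φ) (hβ : β₂ < 1) (hφs : WeakScaling β₁ β₂ φ) (hα : 1 < α₁)
    (hΦ : IsScale α₁ α₂ Φ) (hm : IsDiffusionExponent Φ m) (hest : SubGaussianEstimate μ Φ m q)
    (hn : IsFractionalExponent φ Φ n) :
    ∃ c C : ℝ, 0 < c ∧ 0 < C ∧ ∀ (t : ℝ) (x y : M), 0 < t → 1 ≤ Φ (dist x y) * φ t⁻¹ →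
      ENNReal.ofReal (c * profile μ Φ x (1 / φ t⁻¹) * Real.exp (-(C * n t (dist x y))))
        ≤ fundSol hS q t x y := by
  obtain ⟨C₁, c₁, C₂, c₂, hC₁, hc₁, hC₂, hc₂, hq⟩ := hest.exists_profile_bounds
  obtain ⟨B, hB, hcmp⟩ := hn.compare hφs hα hΦ hm
  obtain ⟨n₁, hn₁, hnlow⟩ := hn.bounded_below hΦ hφs (hβ.trans hα)
  set n₀ := min n₁ 1 with hn₀'
  have hn₀ : 0 < n₀ := by positivity
  obtain ⟨K, C, hK, hC, hmass⟩ := exists_exp_neg_le_passageMeasure_Ioc hS hφ hβ hφs hn₀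
  obtain ⟨A, p, hA, hp, hw⟩ := profile_scaling hV hΦ
  obtain ⟨G, hG, hGe⟩ := rpow_mul_exp_neg_le one_pos one_pos hp
  obtain ⟨-, -, b₁, b₂, -, hb₂, hs⟩ := hφs
  -- As `n₀ ≤ n(t,d)` and `n₀ ≤ 1`, scaling gives `φ(1/t) ≤ bφ(n/t)`; hence both `Ks` and `1/φ(1/t)`
  -- are at most `En/φ(1/t)`.
  set b := b₂ * (1 / n₀) ^ β₂ with hb
  have hb0 : 0 < b := by positivity
  set E := 1 / n₀ + K * b with hE
  have hE0 : 0 < E := by positivity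
  refine ⟨C₁ * (A * E ^ p * G)⁻¹, 1 + c₁ * B + C, by positivity, by positivity,
    fun t x y ht hxy => ?_⟩
  have hd := hΦ.dist_pos_of_one_le hxy
  have hl := hs.pos t⁻¹ (by positivity)
  have hl' : 0 < 1 / φ t⁻¹ := by positivity
  have hNlow := (min_le_left n₁ 1).trans (hnlow t _ ht hd hxy)
  set d := dist x y with hd'
  have hn0 := hn.pos t d ht hd
  have hmB := (hcmp t d ht hd).2
  set N := n t d with hN
  set ν := passageMeasure hS t with hν
  have hpN := hs.pos _ (div_pos hn0 ht)
  have hmassN := hmass t N ht hNlow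
  set s := N / φ (N / t) with hs'
  have hs0 : 0 < s := div_pos hn0 hpN
  set W := profile μ Φ x (1 / φ t⁻¹) with hW
  have hW0 : 0 ≤ W := profile_nonneg _ _
  have hφb : φ t⁻¹ ≤ b * φ (N / t) := by
    have h1 := hs.le_mul (r := n₀ / t) (R := t⁻¹) (by positivity) (by
      rw [inv_eq_one_div]; gcongr; exact min_le_right _ _)
    have e : t⁻¹ / (n₀ / t) = 1 / n₀ := by field_simp
    rw [e] at h1
    refine h1.trans (mul_le_mul_of_nonneg_left ?_ hb0.le)
    exact hs.mono (div_pos hn₀ ht) (div_pos hn0 ht) (by gcongr)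
  -- Moving the profile from `1/φ(1/t)` to `Ks` costs a factor `(EN)^p`, absorbed by `e^N`: this is
  -- the 1 in the rate `1 + c₁B + C`. The order of the two times is not known, hence the maximum
  -- `R`.
  have hWs : W ≤ A * E ^ p * G * Real.exp N * profile μ Φ x (K * s) := by
    have hKs : 0 < K * s := by positivity
    set R := max (K * s) (1 / φ t⁻¹) with hR
    have hR0 : 0 < R := lt_max_of_lt_right hl'
    have hRN : R / (1 / φ t⁻¹) ≤ E * N := by
      rw [div_le_iff₀ hl']
      refine max_le ?_ ?_
      · rw [mul_one_div, le_div_iff₀ hl, hs']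
        calc K * (N / φ (N / t)) * φ t⁻¹ ≤ K * (N / φ (N / t)) * (b * φ (N / t)) := by gcongr
          _ = K * b * N := by field_simp
          _ ≤ E * N := by gcongr; rw [hE]; linarith [one_div_pos.2 hn₀]
      · refine le_mul_of_one_le_left hl'.le ?_
        calc 1 ≤ 1 / n₀ * N := by rw [one_div_mul_eq_div, one_le_div hn₀]; exact hNlow
          _ ≤ E * N := by gcongr; rw [hE]; linarith [mul_pos (one_pos.trans_le hK) hb0]
    have hNp : N ^ p ≤ G * Real.exp N := by
      have := hGe N hn0
      rwa [Real.rpow_one, one_mul, Real.exp_neg, ← div_eq_mul_inv, div_le_iff₀ (Real.exp_pos _)]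
        at this
    have hpR := profile_nonneg (μ := μ) (Φ := Φ) x R
    have hRd : 0 ≤ R / (1 / φ t⁻¹) := by positivity
    calc W ≤ A * (R / (1 / φ t⁻¹)) ^ p * profile μ Φ x R := hw x _ R hl' (le_max_right _ _)
      _ ≤ A * (E * N) ^ p * profile μ Φ x (K * s) := by
          gcongr
          exact profile_anti hV hΦ x hKs (le_max_left _ _)
      _ = A * (E ^ p * N ^ p) * profile μ Φ x (K * s) := by rw [Real.mul_rpow hE0.le hn0.le]
      _ ≤ A * (E ^ p * (G * Real.exp N)) * profile μ Φ x (K * s) := by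
          have := profile_nonneg (μ := μ) (Φ := Φ) x (K * s)
          gcongr
      _ = _ := by ring
  have hWs' : (A * E ^ p * G)⁻¹ * W * Real.exp (-N) ≤ profile μ Φ x (K * s) := by
    rw [Real.exp_neg, mul_assoc, inv_mul_le_iff₀ (by positivity), ← div_eq_mul_inv,
      div_le_iff₀ (Real.exp_pos _)]
    linarith
  calc ENNReal.ofReal (C₁ * (A * E ^ p * G)⁻¹ * W * Real.exp (-((1 + c₁ * B + C) * N)))
      = ENNReal.ofReal (C₁ * ((A * E ^ p * G)⁻¹ * W * Real.exp (-N)) *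
          Real.exp (-(c₁ * (B * N)))) * ENNReal.ofReal (Real.exp (-(C * N))) := by
        rw [← ENNReal.ofReal_mul (by positivity),
          show -((1 + c₁ * B + C) * N) = -N + -(c₁ * (B * N)) + -(C * N) by ring, Real.exp_add,
          Real.exp_add]
        ring_nf
    _ ≤ ENNReal.ofReal (C₁ * profile μ Φ x (K * s) * Real.exp (-(c₁ * (B * N)))) *
          ν (Ioc s (K * s)) := by gcongr
    _ = ∫⁻ _ in Ioc s (K * s),
          ENNReal.ofReal (C₁ * profile μ Φ x (K * s) * Real.exp (-(c₁ * (B * N)))) ∂ν := by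
        rw [setLIntegral_const]
    _ ≤ ∫⁻ r in Ioc s (K * s), ENNReal.ofReal (q r x y) ∂ν := by
        refine setLIntegral_mono' measurableSet_Ioc fun r hr => ENNReal.ofReal_le_ofReal ?_
        have hr0 : 0 < r := hs0.trans hr.1
        refine le_trans ?_ (hq r x y hr0).1
        have h1 := profile_anti hV hΦ x hr0 hr.2
        have h2 : m r d ≤ B * N := (hm.le_of_le hs0 hr.1.le hd.le).trans hmB
        have h3 := profile_nonneg (μ := μ) (Φ := Φ) x r
        gcongr
    _ ≤ _ := setLIntegral_le_lintegral _ _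

end FundamentalSolution

end TimeFractional

/-! ### The two-sided estimates of the fundamental solution -/

theorem theorem1p4
    {M : Type*} [MetricSpace M] [LocallyCompactSpace M] [TopologicalSpace.SeparableSpace M]
    [ConnectedSpace M] [MeasurableSpace M] [BorelSpace M]
    (hchain : TimeFractional.ChainCondition M)
    (μ : MeasureTheory.Measure M) [μ.Regular] [μ.IsOpenPosMeasure]
    (d₁ d₂ : ℝ) (hV : TimeFractional.UniformWeakScaling d₁ d₂ (TimeFractional.vol μ))
    {Ω' : Type*} [MeasurableSpace Ω'] {Q : MeasureTheory.Measure Ω'}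
    [MeasureTheory.IsProbabilityMeasure Q] {S : NNReal → Ω' → ℝ}
    (hS : TimeFractional.IsSubordinator S Q)
    (φ : ℝ → ℝ) (hφ : TimeFractional.HasLaplaceExponent S Q φ)
    (hdrift : TimeFractional.IsDriftless φ)
    (β₁ β₂ : ℝ) (hβ₂ : β₂ < 1) (hφs : TimeFractional.WeakScaling β₁ β₂ φ)
    {Ω : Type*} {mΩ : MeasurableSpace Ω} (ℱ : MeasureTheory.Filtration NNReal mΩ)
    (X : NNReal → Ω → M) (P : M → MeasureTheory.Measure Ω)
    (hX : TimeFractional.IsConservativeDiffusion ℱ X P)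
    (q : ℝ → M → M → ℝ) (hq : TimeFractional.IsHeatKernel μ X P q)
    (α₁ α₂ : ℝ) (hα₁ : 1 < α₁) (Φ : ℝ → ℝ) (hΦ : TimeFractional.IsScale α₁ α₂ Φ)
    (m : ℝ → ℝ → ℝ) (hm : TimeFractional.IsDiffusionExponent Φ m)
    (hest : TimeFractional.SubGaussianEstimate μ Φ m q) :
    -- near-diagonal estimate
    (∃ c₁ c₂ : ℝ, 0 < c₁ ∧ 0 < c₂ ∧ ∀ (t : ℝ) (x y : M), 0 < t →
      Φ (dist x y) * φ t⁻¹ ≤ 1 →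
      ENNReal.ofReal c₁ * (∫⁻ r in Set.Ioc (Φ (dist x y) * φ t⁻¹) 2,
          ENNReal.ofReal (1 / TimeFractional.vol μ x (TimeFractional.inv Φ (r / φ t⁻¹))))
        ≤ TimeFractional.fundSol hS q t x y ∧
      TimeFractional.fundSol hS q t x y
        ≤ ENNReal.ofReal c₂ * (∫⁻ r in Set.Ioc (Φ (dist x y) * φ t⁻¹) 2,
          ENNReal.ofReal (1 / TimeFractional.vol μ x (TimeFractional.inv Φ (r / φ t⁻¹))))) ∧
    -- off-diagonal estimate
    (∃ n : ℝ → ℝ → ℝ, TimeFractional.IsFractionalExponent φ Φ n) ∧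
    (∀ n : ℝ → ℝ → ℝ, TimeFractional.IsFractionalExponent φ Φ n →
      ∃ c₁ c₂ c₃ c₄ : ℝ, 0 < c₁ ∧ 0 < c₂ ∧ 0 < c₃ ∧ 0 < c₄ ∧ ∀ (t : ℝ) (x y : M), 0 < t →
        1 ≤ Φ (dist x y) * φ t⁻¹ →
        ENNReal.ofReal (c₁ / TimeFractional.vol μ x (TimeFractional.inv Φ (1 / φ t⁻¹)) *
            Real.exp (-(c₂ * n t (dist x y))))
          ≤ TimeFractional.fundSol hS q t x y ∧
        TimeFractional.fundSol hS q t x y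
          ≤ ENNReal.ofReal (c₃ / TimeFractional.vol μ x (TimeFractional.inv Φ (1 / φ t⁻¹)) *
            Real.exp (-(c₄ * n t (dist x y))))) := by
  open TimeFractional in
  refine ⟨?_, exists_isFractionalExponent hΦ hφs (hβ₂.trans hα₁), fun n hn => ?_⟩
  · obtain ⟨c₁, hc₁, h₁⟩ := le_fundSol_near hV hS hφ hβ₂ hφs hα₁ hΦ hm hest
    obtain ⟨c₂, hc₂, h₂⟩ := fundSol_near_le hV hS hφ hφs hα₁ hΦ hm hest
    refine ⟨c₁, c₂, hc₁, hc₂, fun t x y ht hxy => ?_⟩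
    obtain ⟨-, -, b₁, b₂, -, -, hs⟩ := hφs
    -- Rescales time from units of `1/φ(1/t)` to actual time.
    have e := setLIntegral_Ioc_comp_div (measurable_profile hV hΦ x).ennreal_ofReal
      (hs.pos t⁻¹ (by positivity)) (Φ (dist x y)) 2
    simp only [profile] at e h₁ h₂
    rw [e]
    exact ⟨h₁ t x y ht, h₂ t x y ht hxy⟩
  · obtain ⟨c₁, c₂, hc₁, hc₂, h₁⟩ := le_fundSol_off_diagonal hV hS hφ hβ₂ hφs hα₁ hΦ hm hest hn
    obtain ⟨c₃, c₄, hc₃, hc₄, h₂⟩ := fundSol_off_diagonal_le hV hS hφ hβ₂ hφs hα₁ hΦ hm hest hn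
    refine ⟨c₁, c₂, c₃, c₄, hc₁, hc₂, hc₃, hc₄, fun t x y ht hxy => ?_⟩
    simp only [profile, mul_one_div] at h₁ h₂
    exact ⟨h₁ t x y ht hxy, h₂ t x y ht hxy⟩
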